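/- Let $\alpha,\beta>0$ and $\epsilon\in[0,1]$. There are constants $c,C>0$, depending only on $\alpha,\beta,\epsilon$, such that the following holds. Let $\Omega\subset\mathbb R^2$ be a bounded open convex domain, and let $A=(a_{ij}):\Omega\to\mathbb R^{2\times 2}$ be measurable and symmetric with $$\alpha\,\xi^T\xi\le \xi^TA(x)\xi\le\beta\,\xi^T\xi\quad(\xi\in\mathbb R^2,\ x\in\Omega),\qquad \frac{|A|^2}{(\operatorname{tr}A)^2}\le\frac1{1+\epsilon}\quad\text{in }\Omega\ \text{(Cordes condition)},$$ where $|A|^2=\sum_{i,j}a_{ij}^2$. Let $\mathcal T_h$ be a finite conforming triangulation of $\overline\Omega$ (so that $\Omega$ is a polygon) with set of vertices $\mathcal N_h$; let $V_h$ be the space of continuous functions on $\overline\Omega$ that are affine on each triangle, $\phi_{\mathbf z}\in V_h$ the nodal shape function of $\mathbf z\in\mathcal N_h$, and $V_h^0=\{v_h\in V_h: v_h|_{\partial\Omega}=0\}$. For each $\mathbf z\in\mathcal N_h$ let a finite set of sampling points in $\overline\Omega$ be given on which no nonzero polynomial of degree at most $2$ vanishes identically. For $v_h\in V_h$ let $p_{\mathbf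 z}$ be the polynomial of degree at most $2$ that is the discrete least-squares fit of $v_h$ on the sampling points of $\mathbf z$, and let $G_hv_h=\sum_{\mathbf z\in\mathcal N_h}\nabla p_{\mathbf z}(\mathbf z)\,\phi_{\mathbf z}\in V_h\times V_h$ (polynomial preserving recovery of the gradient). Let $$V_h^{0,0}=\{v_h\in V_h^0:\ \text{the tangential trace of }G_hv_h\text{ on }\partial\Omega\text{ vanishes}\},$$ and, with $\operatorname{rot}\mathbf w=\partial_yw_1-\partial_xw_2$, $(D\mathbf w)_{ij}=\partial_iw_j$ and $A:B=\sum_{i,j}a_{ij}b_{ij}$, $$a_{1,h}(v_h,w_h)=\sum_{T\in\mathcal T_h}\int_T\big[(A:DG_hv_h)(A:DG_hw_h)+(\operatorname{rot}G_hv_h)(\operatorname{rot}G_hw_h)\big]\,dx\,dy,\qquad \|v_h\|_{a,1}=a_{1,h}(v_h,v_h)^{1/2}.$$ Assume that the mesh is regular enough that the discrete Poincaré inequality $\|v_h\|_{H^i(\Omega)}\le C_P\|G_hv_h\|_{H^i(\Omega)}$ holds for all $v_h\in V_h^0$ and $i=0,1$, with some constant $C_P$. Then for every $f\in L^2(\Omega)$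 the gradient recovery based linear (GRBL) scheme is uniquely solvable: there is exactly one $u_h\in V_h^{0,0}$ with $$a_{1,h}(u_h,v_h)=(f,\,A:DG_hv_h)_{L^2(\Omega)}\qquad\text{for all }v_h\in V_h^{0,0}.$$ Moreover, the energy seminorm is equivalent to $\|DG_hv_h\|_{L^2(\Omega)}$ on $V_h^{0,0}$: $$c\,\|DG_hv_h\|_{L^2(\Omega)}\le\|v_h\|_{a,1}\le C\,\|DG_hv_h\|_{L^2(\Omega)}\qquad\text{for all }v_h\in V_h^{0,0}.$$ -/

import Mathlib

open MeasureTheory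

noncomputable section

namespace RecoveryFEM

/-- The plane `ℝ²` with its Euclidean structure. -/
abbrev Plane : Type := EuclideanSpace ℝ (Fin 2)

/-! ### Triangulations and linear finite elements -/

/-- A (conforming) triangulation of `Ω`: a finite geometric simplicial complex, all of whose maximal
faces are triangles and whose closed triangles cover exactly the closure of `Ω`. -/
structure Triangulation (Ω : Set Plane) extends Geometry.SimplicialComplex ℝ Plane where
  finite_faces : faces.Finite
  exists_triangle : ∀ s ∈ faces, ∃ t ∈ faces, s ⊆ t ∧ t.card = 3
  space_eq : toSimplicialComplex.space = closure Ω

namespace Triangulation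

variable {Ω : Set Plane} (𝒯 : Triangulation Ω)

/-- The triangles, each given by its three vertices. -/
def triangles : Finset (Finset Plane) :=
  𝒯.finite_faces.toFinset.filter fun t => t.card = 3

theorem mem_triangles {t : Finset Plane} : t ∈ 𝒯.triangles ↔ t ∈ 𝒯.faces ∧ t.card = 3 := by
  simp [triangles]

theorem finite_vertices : 𝒯.toSimplicialComplex.vertices.Finite :=
  𝒯.finite_faces.preimage (Finset.singleton_injective.injOn)

/-- The set of vertices of the triangulation. -/
def nodes : Finset Plane := 𝒯.finite_vertices.toFinset

theorem mem_nodes {z : Plane} : z ∈ 𝒯.nodes ↔ {z} ∈ 𝒯.faces := by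
  simp [nodes, Geometry.SimplicialComplex.mem_vertices]

/-- The `C⁰` linear finite element space `V_h`: functions that are continuous on the closure of `Ω`
and affine on each closed triangle. A function on the closure of `Ω` is represented by its
extension by zero to the plane. -/
def feSpace : Set (Plane → ℝ) :=
  {v | ContinuousOn v (closure Ω) ∧
    (∀ t ∈ 𝒯.triangles, ∃ l : Plane →ᵃ[ℝ] ℝ, Set.EqOn v l (convexHull ℝ (t : Set Plane))) ∧
    ∀ x, x ∉ closure Ω → v x = 0}

/-- The space `V_h^0` of finite element functions that vanish on the boundary. -/
def feSpaceZero : Set (Plane → ℝ) :=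
  {v | v ∈ 𝒯.feSpace ∧ ∀ x ∈ frontier Ω, v x = 0}

theorem mem_closure_iff {x : Plane} :
    x ∈ closure Ω ↔ ∃ t ∈ 𝒯.triangles, x ∈ convexHull ℝ (t : Set Plane) := by
  rw [← 𝒯.space_eq, Geometry.SimplicialComplex.mem_space_iff]
  constructor
  · rintro ⟨s, hs, hx⟩
    obtain ⟨t, ht, hst, hc⟩ := 𝒯.exists_triangle s hs
    exact ⟨t, 𝒯.mem_triangles.2 ⟨ht, hc⟩, convexHull_mono (Finset.coe_subset.2 hst) hx⟩
  · rintro ⟨t, ht, hx⟩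
    exact ⟨t, (𝒯.mem_triangles.1 ht).1, hx⟩

theorem eqOn_convexHull {s : Set Plane} {l l' : Plane →ᵃ[ℝ] ℝ} (h : Set.EqOn l l' s) :
    Set.EqOn l l' (convexHull ℝ s) := by
  have hconv : Convex ℝ {x | l x = l' x} := by
    intro x hx y hy a b ha hb hab
    simp only [Set.mem_ofPred_eq] at *
    rw [Convex.combo_affine_apply hab, Convex.combo_affine_apply hab, hx, hy]
  exact convexHull_min h hconv

theorem exists_affine {t : Finset Plane} (ht : t ∈ 𝒯.triangles) (g : Plane → ℝ) :
    ∃ l : Plane →ᵃ[ℝ] ℝ, ∀ y ∈ t, l y = g y := by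
  obtain ⟨hf, hc⟩ := 𝒯.mem_triangles.1 ht
  have hind := 𝒯.indep hf
  have htop : affineSpan ℝ (Set.range ((↑) : t → Plane)) = ⊤ := by
    rw [hind.affineSpan_eq_top_iff_card_eq_finrank_add_one]
    simp [hc]
  let b : AffineBasis t ℝ Plane := ⟨(↑), hind, htop⟩
  refine ⟨∑ y : t, g y • b.coord y, fun y hy => ?_⟩
  have h1 : ∀ i : t, b.coord i y = if i = ⟨y, hy⟩ then 1 else 0 := by
    intro i
    exact b.coord_apply i ⟨y, hy⟩
  have h2 : ∀ s : Finset t, (∑ i ∈ s, g i • b.coord i) y = ∑ i ∈ s, g i * b.coord i y := by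
    intro s
    induction s using Finset.induction_on with
    | empty => simp
    | insert a s ha ih => rw [Finset.sum_insert ha, Finset.sum_insert ha, ← ih]; simp
  rw [h2]
  simp [h1]

/-- Nodal values determine a unique finite element function. -/
theorem existsUnique_nodal (g : Plane → ℝ) :
    ∃! w : Plane → ℝ, w ∈ 𝒯.feSpace ∧ ∀ z ∈ 𝒯.nodes, w z = g z := by
  classical
  have hnode : ∀ t ∈ 𝒯.triangles, ∀ y ∈ t, y ∈ 𝒯.nodes := fun t ht y hy =>
    𝒯.mem_nodes.2 (𝒯.down_closed (𝒯.mem_triangles.1 ht).1 (Finset.singleton_subset_iff.2 hy)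
      (Finset.singleton_nonempty y))
  choose! l hl using fun t (ht : t ∈ 𝒯.triangles) => 𝒯.exists_affine ht g
  have hcomp : ∀ s ∈ 𝒯.triangles, ∀ t ∈ 𝒯.triangles, ∀ x ∈ convexHull ℝ (s : Set Plane),
      x ∈ convexHull ℝ (t : Set Plane) → l s x = l t x := by
    intro s hs t ht x hxs hxt
    refine eqOn_convexHull (s := (s ∩ t : Set Plane)) ?_ (𝒯.inter_subset_convexHull
      (𝒯.mem_triangles.1 hs).1 (𝒯.mem_triangles.1 ht).1 ⟨hxs, hxt⟩)
    rintro y ⟨hys, hyt⟩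
    rw [hl s hs y hys, hl t ht y hyt]
  let w : Plane → ℝ := fun x =>
    if h : ∃ t ∈ 𝒯.triangles, x ∈ convexHull ℝ (t : Set Plane) then l h.choose x else 0
  have hw : ∀ t ∈ 𝒯.triangles, Set.EqOn w (l t) (convexHull ℝ (t : Set Plane)) := by
    intro t ht x hx
    have h : ∃ t ∈ 𝒯.triangles, x ∈ convexHull ℝ (t : Set Plane) := ⟨t, ht, hx⟩
    simp only [w, dif_pos h]
    exact hcomp _ h.choose_spec.1 _ ht _ h.choose_spec.2 hx
  refine ⟨w, ⟨⟨?_, fun t ht => ⟨l t, hw t ht⟩, fun x hx => ?_⟩, fun z hz => ?_⟩, ?_⟩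
  · have hU : closure Ω = ⋃ t : 𝒯.triangles, convexHull ℝ (t.1 : Set Plane) := by
      ext x
      simp [𝒯.mem_closure_iff]
    rw [hU]
    refine (locallyFinite_of_finite _).continuousOn_iUnion (fun t => ?_) (fun t => ?_)
    · exact (t.1.finite_toSet.isCompact_convexHull ℝ).isClosed
    · exact ((l t.1).continuous_of_finiteDimensional.continuousOn).congr (hw t.1 t.2)
  · have h : ¬ ∃ t ∈ 𝒯.triangles, x ∈ convexHull ℝ (t : Set Plane) := by
      rwa [← 𝒯.mem_closure_iff]
    simp only [w, dif_neg h]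
  · obtain ⟨t, ht, hzt, hc⟩ := 𝒯.exists_triangle _ (𝒯.mem_nodes.1 hz)
    have hzt' : z ∈ t := hzt (Finset.mem_singleton_self z)
    have ht' := 𝒯.mem_triangles.2 ⟨ht, hc⟩
    rw [hw t ht' (subset_convexHull ℝ _ hzt'), hl t ht' z hzt']
  · rintro v ⟨⟨-, hv, hv0⟩, hvg⟩
    funext x
    by_cases hx : x ∈ closure Ω
    · obtain ⟨t, ht, hxt⟩ := 𝒯.mem_closure_iff.1 hx
      obtain ⟨m, hm⟩ := hv t ht
      rw [hm hxt, hw t ht hxt]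
      refine eqOn_convexHull (fun y hy => ?_) hxt
      rw [← hm (subset_convexHull ℝ _ hy), hvg y (hnode t ht y hy), hl t ht y hy]
    · have h : ¬ ∃ t ∈ 𝒯.triangles, x ∈ convexHull ℝ (t : Set Plane) := by
        rwa [← 𝒯.mem_closure_iff]
      rw [hv0 x hx]
      simp only [w, dif_neg h]

open Classical in
/-- The nodal shape function `φ_z`: the finite element function with value `1` at `z` and `0` at all
other vertices. -/
def shape (z : Plane) : Plane → ℝ :=
  (𝒯.existsUnique_nodal fun y => if y = z then 1 else 0).choose

end Triangulation

/-! ### Polynomial preserving recovery of the gradient -/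

/-- Real polynomials in two variables of total degree at most two. -/
abbrev quadratics : Submodule ℝ (MvPolynomial (Fin 2) ℝ) :=
  MvPolynomial.restrictTotalDegree (Fin 2) ℝ 2

/-- The value of a polynomial at a point of the plane. -/
def polyVal (p : MvPolynomial (Fin 2) ℝ) (x : Plane) : ℝ := MvPolynomial.eval (fun i => x i) p

/-- A quadratic polynomial is determined by its values on the finite set `P`. -/
def Unisolvent (P : Finset Plane) : Prop :=
  ∀ p ∈ quadratics, (∀ x ∈ P, polyVal p x = 0) → p = 0

/-- The quadratic polynomial `p` is the discrete least-squares fit of `v` on the points `P`. -/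
def IsQuadraticFit (P : Finset Plane) (v : Plane → ℝ) (p : MvPolynomial (Fin 2) ℝ) : Prop :=
  p ∈ quadratics ∧ ∀ q ∈ quadratics, ∑ x ∈ P, (polyVal p x - v x) * polyVal q x = 0

theorem existsUnique_quadraticFit {P : Finset Plane} (hP : Unisolvent P) (v : Plane → ℝ) :
    ∃! p, IsQuadraticFit P v p := by
  let ev (x : Plane) : quadratics →ₗ[ℝ] ℝ :=
    (MvPolynomial.aeval (fun i => x i)).toLinearMap ∘ₗ quadratics.subtype
  have hev : ∀ x (p : quadratics), ev x p = polyVal p x := fun x p => by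
    simp [ev, polyVal, MvPolynomial.aeval_eq_eval]
  let L : quadratics →ₗ[ℝ] Module.Dual ℝ quadratics := ∑ x ∈ P, (ev x).smulRight (ev x)
  have hL : ∀ p q, L p q = ∑ x ∈ P, polyVal p x * polyVal q x := fun p q => by
    simp [L, LinearMap.sum_apply, hev]
  have hinj : Function.Injective L := by
    rw [injective_iff_map_eq_zero]
    intro p hp
    have h0 : ∑ x ∈ P, polyVal p x * polyVal p x = 0 := by rw [← hL, hp]; rfl
    rw [Finset.sum_eq_zero_iff_of_nonneg fun x _ => mul_self_nonneg _] at h0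
    exact Subtype.ext (hP p p.2 fun x hx => mul_self_eq_zero.1 (h0 x hx))
  have hsurj : Function.Surjective L :=
    (LinearMap.injective_iff_surjective_of_finrank_eq_finrank
      (Subspace.dual_finrank_eq (K := ℝ) (V := quadratics)).symm).1 hinj
  obtain ⟨p, hp⟩ := hsurj (∑ x ∈ P, v x • ev x)
  have hp' : ∀ q ∈ quadratics, ∑ x ∈ P, polyVal p x * polyVal q x = ∑ x ∈ P, v x * polyVal q x := by
    intro q hq
    have h := congrArg (fun φ => φ ⟨q, hq⟩) hp
    simpa [hL, LinearMap.sum_apply, hev] using h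
  refine ⟨p, ⟨p.2, fun q hq => ?_⟩, fun r hr => ?_⟩
  · simp only [sub_mul, Finset.sum_sub_distrib, hp' q hq, sub_self]
  · have : L ⟨r, hr.1⟩ = L p := by
      ext q
      have h := hr.2 q q.2
      simp only [sub_mul, Finset.sum_sub_distrib, sub_eq_zero] at h
      rw [hL, hL, h, hp' q q.2]
    exact congrArg Subtype.val (hinj this)

variable {Ω : Set Plane} {𝒯 : Triangulation Ω}

/-- The sampling points of polynomial preserving recovery: for each vertex `z`, finitely many points
of the mesh domain that determine quadratic polynomials. They may lie in the element patch of `z`,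
or in a larger patch, as is customary near the boundary. -/
structure Sampling (𝒯 : Triangulation Ω) where
  pts : 𝒯.nodes → Finset Plane
  pts_subset : ∀ z, (pts z : Set Plane) ⊆ closure Ω
  unisolvent : ∀ z, Unisolvent (pts z)

/-- The quadratic polynomial fitted to `v` at the vertex `z`. -/
def Sampling.fit (S : Sampling 𝒯) (v : Plane → ℝ) (z : 𝒯.nodes) : MvPolynomial (Fin 2) ℝ :=
  (existsUnique_quadraticFit (S.unisolvent z) v).choose

/-- The recovered gradient `G_h v = ∑_z ∇p_z(z) φ_z`, as a pair of components. -/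
def Sampling.grad (S : Sampling 𝒯) (v : Plane → ℝ) : Fin 2 → Plane → ℝ := fun i x =>
  ∑ z : 𝒯.nodes, polyVal (MvPolynomial.pderiv i (S.fit v z)) z * 𝒯.shape z x

/-! ### Differential operators and norms -/

/-- The partial derivative `∂_i v`. For finite element functions it is defined in the interior of
each triangle, hence almost everywhere in `Ω`. -/
def partialDeriv (i : Fin 2) (v : Plane → ℝ) (x : Plane) : ℝ :=
  fderiv ℝ v x (EuclideanSpace.single i 1)

/-- The matrix `(D w)_{ij} = ∂_i w_j`. -/
def jac (w : Fin 2 → Plane → ℝ) (x : Plane) : Matrix (Fin 2) (Fin 2) ℝ :=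
  Matrix.of fun i j => partialDeriv i (w j) x

/-- `rot w = ∂_y w_1 - ∂_x w_2`. -/
def rot (w : Fin 2 → Plane → ℝ) (x : Plane) : ℝ :=
  partialDeriv 1 (w 0) x - partialDeriv 0 (w 1) x

/-- The Frobenius product `A : B`. -/
def frob (A B : Matrix (Fin 2) (Fin 2) ℝ) : ℝ := ∑ i, ∑ j, A i j * B i j

/-- The `L²(Ω)` norm of a scalar or vector field, given by its components. -/
def norm0 {ι : Type} [Fintype ι] (Ω : Set Plane) (w : ι → Plane → ℝ) : ℝ :=
  Real.sqrt (∑ k, ∫ x in Ω, w k x ^ 2)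

/-- The `H¹(Ω)` norm of a scalar or vector field, given by its components. -/
def norm1 {ι : Type} [Fintype ι] (Ω : Set Plane) (w : ι → Plane → ℝ) : ℝ :=
  Real.sqrt (∑ k, ∫ x in Ω, (w k x ^ 2 + ∑ i, partialDeriv i (w k) x ^ 2))

/-- The norm `‖D w‖_{L²(Ω)}`. -/
def normJac (Ω : Set Plane) (w : Fin 2 → Plane → ℝ) : ℝ :=
  Real.sqrt (∫ x in Ω, frob (jac w x) (jac w x))

/-- The tangential trace of `w` vanishes on the boundary of a polygon `Ω`: on every segment that lies
in the boundary, `w` is orthogonal to the direction of the segment. -/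
def TangentialTraceZero (Ω : Set Plane) (w : Fin 2 → Plane → ℝ) : Prop :=
  ∀ p q : Plane, segment ℝ p q ⊆ frontier Ω →
    ∀ x ∈ segment ℝ p q, ∑ i, w i x * (q i - p i) = 0

/-! ### The gradient recovery based linear finite element scheme -/

/-- The space `V_h^{0,0}`. -/
def Sampling.spaceZeroZero (S : Sampling 𝒯) : Set (Plane → ℝ) :=
  {v | v ∈ 𝒯.feSpaceZero ∧ TangentialTraceZero Ω (S.grad v)}

/-- The discrete Poincaré inequality `‖v_h‖_i ≲ ‖G_h v_h‖_i` on `V_h^0`, for `i = 0, 1`. -/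
def Sampling.DiscretePoincare (S : Sampling 𝒯) : Prop :=
  ∃ C : ℝ, ∀ v ∈ 𝒯.feSpaceZero,
    norm0 Ω (fun _ : Unit => v) ≤ C * norm0 Ω (S.grad v) ∧
    norm1 Ω (fun _ : Unit => v) ≤ C * norm1 Ω (S.grad v)

/-- The bilinear form `a_{1,h}`. -/
def Sampling.form (S : Sampling 𝒯) (A : Plane → Matrix (Fin 2) (Fin 2) ℝ) (v w : Plane → ℝ) : ℝ :=
  ∑ t ∈ 𝒯.triangles, ∫ x in convexHull ℝ (t : Set Plane),
    (frob (A x) (jac (S.grad v) x) * frob (A x) (jac (S.grad w) x) +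
      rot (S.grad v) x * rot (S.grad w) x)

/-- The energy seminorm `‖v‖_{a,1}`. -/
def Sampling.energy (S : Sampling 𝒯) (A : Plane → Matrix (Fin 2) (Fin 2) ℝ) (v : Plane → ℝ) : ℝ :=
  Real.sqrt (S.form A v v)

/-- `u` solves the scheme: `u ∈ V_h^{0,0}` and `a_{1,h}(u, v) = (f, A : D G_h v)` for all
`v ∈ V_h^{0,0}`. -/
def Sampling.IsSolution (S : Sampling 𝒯) (A : Plane → Matrix (Fin 2) (Fin 2) ℝ) (f : Plane → ℝ)
    (u : Plane → ℝ) : Prop :=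
  u ∈ S.spaceZeroZero ∧ ∀ v ∈ S.spaceZeroZero,
    S.form A u v = ∫ x in Ω, f x * frob (A x) (jac (S.grad v) x)

/-- Coefficients on `Ω` that are measurable, symmetric, uniformly elliptic with bounds `α, β`, and
satisfy the Cordes condition with parameter `ε` in dimension `d = 2`. -/
structure IsCordesCoefficient (Ω : Set Plane) (α β ε : ℝ)
    (A : Plane → Matrix (Fin 2) (Fin 2) ℝ) : Prop where
  aemeasurable : ∀ i j, AEMeasurable (fun x => A x i j) (volume.restrict Ω)
  symm : ∀ x ∈ Ω, (A x).IsSymm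
  elliptic : ∀ x ∈ Ω, ∀ ξ : Fin 2 → ℝ,
    α * (ξ ⬝ᵥ ξ) ≤ ξ ⬝ᵥ (A x).mulVec ξ ∧ ξ ⬝ᵥ (A x).mulVec ξ ≤ β * (ξ ⬝ᵥ ξ)
  cordes : ∀ x ∈ Ω, frob (A x) (A x) / (A x).trace ^ 2 ≤ 1 / (2 - 1 + ε)

end RecoveryFEM

end

noncomputable section

namespace RecoveryFEM

open Filter Topology

/-! ### Oriented areas -/

/-! Write W = G_h v for v in V_h^{0,0} and D = DW. Everything rests on a discrete Miranda–Talenti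
identity: det D is a null Lagrangian, so its integral over Ω depends only on boundary values, and it
vanishes because W is normal to the boundary. As |D|² = (div W)² + (rot W)² - 2 det D pointwise, the
squared L² norm of D equals that of div W plus that of rot W.

For the continuous piecewise affine field W this needs no integration by parts. On one triangle,
area times det D is a signed sum of the cross products of W(a) and W(b) over the edges ab. An
interior edge belongs to exactly two triangles, of opposite orientation, so its terms cancel. On a
boundary edge both values are orthogonal to the edge, hence parallel. These facts are
`area_mul_det`, `sum_sign_orient` and `sum_cross_eq_zero`, collected in `integral_det_jac`.

It remains to replace div W by A : D. With γ = tr A / |A|² the matrix γA - I has squared norm 2 -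
(tr A)²/|A|². In dimension two, ellipticity bounds this by 1 - ρ with ρ = α²/β², so div W = γ A : D
- (γA - I) : D is a perturbation that Young's inequality absorbs (`cordes_pointwise`). Integration
gives the lower bound; the upper bound is Cauchy–Schwarz.

For unique solvability, a v of zero energy has D = 0, so W is constant. A constant field normal to
all sides of a bounded polygon is zero (`const_eq_zero_of_tangentialTraceZero`), and the discrete
Poincaré inequality gives v = 0. Since V_h^{0,0} is finite-dimensional, definiteness yields
existence and uniqueness. -/

/-- The planar cross product. -/
def cross (u v : Plane) : ℝ := u 0 * v 1 - u 1 * v 0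

/-- For two vertices `a, b` of the triangle `t` with third vertex `c`, this is
`cross (b - a) (c - a)`, twice the oriented area of `a b c`. -/
def orient (t : Finset Plane) (a b : Plane) : ℝ := ∑ c ∈ t, cross (b - a) (c - a)

theorem exists_third {t : Finset Plane} {a b : Plane} (ht : t.card = 3) (ha : a ∈ t) (hb : b ∈ t)
    (hab : a ≠ b) : ∃ c, t = {a, b, c} ∧ a ≠ c ∧ b ≠ c := by
  classical
  have hb' : b ∈ t.erase a := Finset.mem_erase.2 ⟨hab.symm, hb⟩
  have h : ((t.erase a).erase b).card = 1 := by
    rw [Finset.card_erase_of_mem hb', Finset.card_erase_of_mem ha, ht]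
  obtain ⟨c, hc⟩ := Finset.card_eq_one.1 h
  have hct : c ∈ (t.erase a).erase b := by simp [hc]
  simp only [Finset.mem_erase] at hct
  exact ⟨c, by rw [← hc, Finset.insert_erase hb', Finset.insert_erase ha], hct.2.1.symm,
    hct.1.symm⟩

/-- Summing over all vertices avoids naming the third one: the summands at a and at b vanish. -/
theorem orient_triple {a b c : Plane} (hab : a ≠ b) (hac : a ≠ c) (hbc : b ≠ c) :
    orient {a, b, c} a b = cross (b - a) (c - a) := by
  classical
  rw [orient, Finset.sum_insert (by simp [hab, hac]), Finset.sum_insert (by simp [hbc]),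
    Finset.sum_singleton]
  simp only [cross, PiLp.sub_apply]
  ring

theorem orient_swap {t : Finset Plane} {a b : Plane} (ht : t.card = 3) (ha : a ∈ t) (hb : b ∈ t) :
    orient t b a = - orient t a b := by
  classical
  by_cases hab : a = b
  · subst hab; simp [orient, cross]
  obtain ⟨c, rfl, hac, hbc⟩ := exists_third ht ha hb hab
  rw [orient_triple hab hac hbc, Finset.insert_comm, orient_triple (Ne.symm hab) hbc hac]
  simp only [cross, PiLp.sub_apply]
  ring

/-- The linear map sending the standard basis to `u`, `v`. -/
def frameMap (u v : Plane) : Plane →ₗ[ℝ] Plane :=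
  Matrix.toLin (EuclideanSpace.basisFun (Fin 2) ℝ).toBasis (EuclideanSpace.basisFun (Fin 2) ℝ).toBasis
    !![u 0, v 0; u 1, v 1]

theorem frameMap_apply (u v x : Plane) : frameMap u v x = x 0 • u + x 1 • v := by
  ext i
  rw [frameMap, Matrix.toLin_apply]
  fin_cases i <;>
    simp [Matrix.mulVec, dotProduct, Fin.sum_univ_two] <;> ring

theorem det_frameMap (u v : Plane) : LinearMap.det (frameMap u v) = cross u v := by
  rw [frameMap, LinearMap.det_toLin, Matrix.det_fin_two_of, cross]
  ring

/-- The area of the reference triangle. -/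
def refArea : ℝ :=
  (volume (convexHull ℝ ({0, EuclideanSpace.single 0 1, EuclideanSpace.single 1 1} : Set Plane))).toReal

/-- The triangle is an affine image of the reference triangle. The value of `refArea` is never
needed, since it only multiplies a sum that vanishes. -/
theorem volume_triangle (a b c : Plane) :
    (volume (convexHull ℝ ({a, b, c} : Set Plane))).toReal = |cross (b - a) (c - a)| * refArea := by
  have h : convexHull ℝ ({a, b, c} : Set Plane) = (fun x => a + x) '' (frameMap (b - a) (c - a) ''
      convexHull ℝ ({0, EuclideanSpace.single 0 1, EuclideanSpace.single 1 1} : Set Plane)) := by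
    rw [LinearMap.image_convexHull]
    have : (fun x : Plane => a + x) = (AffineEquiv.constVAdd ℝ Plane a).toAffineMap := by
      ext x; simp
    rw [this, AffineMap.image_convexHull]
    simp [Set.image_insert_eq, frameMap_apply]
  rw [h, Set.image_add_left, measure_preimage_add, Measure.addHaar_image_linearMap, det_frameMap, ENNReal.toReal_mul,
    ENNReal.toReal_ofReal (abs_nonneg _), refArea]

/-- The directional derivatives of an affine function. -/
theorem affine_apply_eq (l : Plane →ᵃ[ℝ] ℝ) (x y : Plane) :
    l y = l x + l.linear (EuclideanSpace.single 0 1) * (y 0 - x 0) +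
      l.linear (EuclideanSpace.single 1 1) * (y 1 - x 1) := by
  have h : l y = l.linear (y - x) + l x := by
    have := l.map_vadd x (y - x)
    simpa using this
  have h2 : y - x = (y 0 - x 0) • EuclideanSpace.single 0 1 +
      (y 1 - x 1) • (EuclideanSpace.single 1 1 : Plane) := by
    ext i; fin_cases i <;> simp
  rw [h, h2, map_add, map_smul, map_smul, smul_eq_mul, smul_eq_mul]
  ring

/-- Stokes' formula on one triangle: the affine map (l, m) multiplies oriented area by its
determinant, and the oriented area of the image is a cyclic sum of cross products of consecutive
vertices. Each edge occurs in both directions with the same contribution, hence the factor 1/2. -/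
theorem area_mul_det {t : Finset Plane} (ht : t.card = 3) (l m : Plane →ᵃ[ℝ] ℝ) :
    (volume (convexHull ℝ (t : Set Plane))).toReal *
      (l.linear (EuclideanSpace.single 0 1) * m.linear (EuclideanSpace.single 1 1) -
        l.linear (EuclideanSpace.single 1 1) * m.linear (EuclideanSpace.single 0 1)) =
      refArea / 2 * ∑ a ∈ t, ∑ b ∈ t, (l a * m b - m a * l b) * SignType.sign (orient t a b) := by
  classical
  obtain ⟨a, b, c, hab, hac, hbc, rfl⟩ := Finset.card_eq_three.1 ht
  have e1 : orient {a, b, c} a b = cross (b - a) (c - a) := orient_triple hab hac hbc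
  have e2 : orient {a, b, c} b c = cross (b - a) (c - a) := by
    rw [show ({a, b, c} : Finset Plane) = {b, c, a} by ext; simp; tauto,
      orient_triple hbc hab.symm hac.symm]
    simp only [cross, PiLp.sub_apply]; ring
  have e3 : orient {a, b, c} c a = cross (b - a) (c - a) := by
    rw [show ({a, b, c} : Finset Plane) = {c, a, b} by ext; simp; tauto,
      orient_triple hac.symm hbc.symm hab]
    simp only [cross, PiLp.sub_apply]; ring
  have e4 := orient_swap (a := a) (b := b) ht (by simp) (by simp)
  have e5 := orient_swap (a := b) (b := c) ht (by simp) (by simp)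
  have e6 := orient_swap (a := c) (b := a) ht (by simp) (by simp)
  have hs : ∀ f : Plane → ℝ, ∑ x ∈ ({a, b, c} : Finset Plane), f x = f a + f b + f c := by
    intro f
    rw [Finset.sum_insert (by simp [hab, hac]), Finset.sum_insert (by simp [hbc]),
      Finset.sum_singleton, add_assoc]
  simp only [hs, e4, e5, e6, e1, e2, e3, Left.sign_neg, SignType.coe_neg]
  -- Once the absolute value is written as sign times value, both sides are linear in the sign s,
  -- and the identity is polynomial for arbitrary s.
  have hv : ((({a, b, c} : Finset Plane)) : Set Plane) = {a, b, c} := by simp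
  rw [hv, volume_triangle, affine_apply_eq l a b, affine_apply_eq l a c, affine_apply_eq m a b,
    affine_apply_eq m a c, ← sign_mul_self (cross (b - a) (c - a))]
  generalize ((SignType.sign (cross (b - a) (c - a)) : SignType) : ℝ) = s
  simp only [cross, PiLp.sub_apply]
  ring

/-! ### Edges of the triangulation -/

namespace Triangulation

variable {Ω : Set Plane} (𝒯 : Triangulation Ω)

theorem mem_nodes_of_mem {t : Finset Plane} (ht : t ∈ 𝒯.triangles) {a : Plane} (ha : a ∈ t) :
    a ∈ 𝒯.nodes :=
  𝒯.mem_nodes.2 (𝒯.down_closed (𝒯.mem_triangles.1 ht).1 (Finset.singleton_subset_iff.2 ha)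
    (Finset.singleton_nonempty a))

theorem convexHull_subset_closure {t : Finset Plane} (ht : t ∈ 𝒯.triangles) :
    convexHull ℝ (t : Set Plane) ⊆ closure Ω := fun _ hx => 𝒯.mem_closure_iff.2 ⟨t, ht, hx⟩

theorem mem_closure_of_mem {t : Finset Plane} (ht : t ∈ 𝒯.triangles) {a : Plane} (ha : a ∈ t) :
    a ∈ closure Ω := 𝒯.convexHull_subset_closure ht (subset_convexHull ℝ _ ha)

/-- If a convex combination of points of the closure of an open convex set lies outside this set,
then the segments between the points with positive weights lie in the boundary. -/
theorem segment_subset_frontier (ho : IsOpen Ω) (hc : Convex ℝ Ω) {t : Finset Plane}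
    (ht : ∀ y ∈ t, y ∈ closure Ω) {w : Plane → ℝ} (hw : ∀ y ∈ t, 0 ≤ w y) (hw1 : ∑ y ∈ t, w y = 1)
    (hx : ∑ y ∈ t, w y • y ∉ Ω) {a b : Plane} (ha : a ∈ t) (hb : b ∈ t) (hwa : 0 < w a)
    (hwb : 0 < w b) : segment ℝ a b ⊆ frontier Ω := by
  obtain ⟨f, hf⟩ := geometric_hahn_banach_open_point hc ho hx
  set x := ∑ y ∈ t, w y • y with hxdef
  have hcl : ∀ y ∈ closure Ω, f y ≤ f x := fun y hy =>
    closure_minimal (fun z hz => (hf z hz).le) (isClosed_le f.continuous continuous_const) hy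
  have hsum : ∑ y ∈ t, w y * (f x - f y) = 0 := by
    have : f x = ∑ y ∈ t, w y * f y := by simp [hxdef, map_sum]
    simp only [mul_sub, Finset.sum_sub_distrib, ← Finset.sum_mul, hw1, ← this]
    ring
  have hz := (Finset.sum_eq_zero_iff_of_nonneg fun y hy =>
    mul_nonneg (hw y hy) (sub_nonneg.2 (hcl y (ht y hy)))).1 hsum
  have hfa : f a = f x := by
    have := (mul_eq_zero.1 (hz a ha)).resolve_left hwa.ne'
    linarith
  have hfb : f b = f x := by
    have := (mul_eq_zero.1 (hz b hb)).resolve_left hwb.ne'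
    linarith
  intro y hy
  rw [ho.frontier_eq]
  refine ⟨hc.closure.segment_subset (ht a ha) (ht b hb) hy, fun hyΩ => ?_⟩
  obtain ⟨r, s, hr, hs, hrs, rfl⟩ := hy
  have h := hf _ hyΩ
  rw [map_add, map_smul, map_smul, hfa, hfb, smul_eq_mul, smul_eq_mul, ← add_mul, hrs, one_mul] at h
  exact lt_irrefl _ h

/-- A supporting line at the midpoint contains both endpoints. Hence the midpoint alone decides
whether an edge is interior or lies in the boundary. -/
theorem edge_subset_frontier (ho : IsOpen Ω) (hc : Convex ℝ Ω) {a b : Plane}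
    (ha : a ∈ closure Ω) (hb : b ∈ closure Ω) (hm : midpoint ℝ a b ∉ Ω) :
    segment ℝ a b ⊆ frontier Ω := by
  classical
  by_cases hab : a = b
  · subst hab
    simpa [ho.frontier_eq] using ⟨ha, by simpa using hm⟩
  refine segment_subset_frontier ho hc (t := {a, b}) (w := fun _ => 1 / 2) ?_ ?_ ?_ ?_
    (by simp) (by simp) (by norm_num) (by norm_num)
  · simp [ha, hb]
  · intros; norm_num
  · rw [Finset.sum_pair hab]; norm_num
  · rw [Finset.sum_pair hab]
    convert hm using 1
    rw [midpoint_eq_smul_add]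
    simp

theorem sq_add_sq_pos {a b : Plane} (hab : a ≠ b) :
    0 < (b 0 - a 0) ^ 2 + (b 1 - a 1) ^ 2 := by
  by_contra! h
  apply hab
  ext i
  fin_cases i <;> simp <;> nlinarith [sq_nonneg (b 0 - a 0), sq_nonneg (b 1 - a 1)]

theorem cross_ne_zero {a b c : Plane} (h : ({a, b, c} : Finset Plane) ∈ 𝒯.triangles)
    (hab : a ≠ b) (hac : a ≠ c) (hbc : b ≠ c) : cross (b - a) (c - a) ≠ 0 := by
  classical
  intro h0
  have hind := 𝒯.indep (𝒯.mem_triangles.1 h).1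
  have hcol : ¬ Collinear ℝ ({a, b, c} : Set Plane) := by
    have h3 : AffineIndependent ℝ ![a, b, c] := by
      have hinj : Function.Injective (fun i : Fin 3 =>
          (⟨![a, b, c] i, by fin_cases i <;> simp⟩ : ({a, b, c} : Finset Plane))) := by
        intro i j hij
        simp only [Subtype.mk.injEq] at hij
        fin_cases i <;> fin_cases j <;> simp_all
      exact hind.comp_embedding ⟨_, hinj⟩
    rwa [affineIndependent_iff_not_collinear_set] at h3
  apply hcol
  rw [collinear_iff_of_mem (p₀ := a) (by simp)]
  refine ⟨b - a, ?_⟩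
  have hne : (b - a) 0 ^ 2 + (b - a) 1 ^ 2 ≠ 0 := (sq_add_sq_pos hab).ne'
  intro p hp
  simp only [Set.mem_insert_iff, Set.mem_singleton_iff] at hp
  rcases hp with rfl | rfl | rfl
  · exact ⟨0, by simp⟩
  · exact ⟨1, by simp⟩
  -- The coefficient of the orthogonal projection of p - a onto b - a; as the cross product is zero,
  -- the projection is p - a itself.
  · refine ⟨((p - a) 0 * (b - a) 0 + (p - a) 1 * (b - a) 1) / ((b - a) 0 ^ 2 + (b - a) 1 ^ 2), ?_⟩
    simp only [cross] at h0
    ext i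
    rw [vadd_eq_add, PiLp.add_apply, PiLp.smul_apply, smul_eq_mul, ← sub_eq_iff_eq_add,
      ← PiLp.sub_apply]
    fin_cases i
    · simp only [Fin.zero_eta, Fin.isValue]
      field_simp
      linear_combination (-(b - a) 1) * h0
    · simp only [Fin.mk_one, Fin.isValue]
      field_simp
      linear_combination ((b - a) 0) * h0

theorem orient_ne_zero {t : Finset Plane} (ht : t ∈ 𝒯.triangles) {a b : Plane} (ha : a ∈ t)
    (hb : b ∈ t) (hab : a ≠ b) : orient t a b ≠ 0 := by
  obtain ⟨c, rfl, hac, hbc⟩ := exists_third (𝒯.mem_triangles.1 ht).2 ha hb hab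
  rw [orient_triple hab hac hbc]
  exact 𝒯.cross_ne_zero ht hab hac hbc

/-- A triangle that contains the midpoint of an edge contains the edge. -/
theorem mem_of_midpoint_mem {s t : Finset Plane} (hs : s ∈ 𝒯.triangles) (ht : t ∈ 𝒯.triangles)
    {a b : Plane} (ha : a ∈ s) (hb : b ∈ s) (hab : a ≠ b)
    (hm : midpoint ℝ a b ∈ convexHull ℝ (t : Set Plane)) : a ∈ t := by
  classical
  by_contra hat
  have hf : ({a, b} : Finset Plane) ∈ 𝒯.faces :=
    𝒯.down_closed (𝒯.mem_triangles.1 hs).1 (by simp [Finset.insert_subset_iff, ha, hb]) (by simp)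
  have h := 𝒯.inter_subset_convexHull hf (𝒯.mem_triangles.1 ht).1
    ⟨by simpa [convexHull_pair] using midpoint_mem_segment a b, hm⟩
  have h2 : midpoint ℝ a b ∈ convexHull ℝ ({b} : Set Plane) := by
    refine convexHull_mono ?_ h
    rintro y ⟨hy, hyt⟩
    simp only [Finset.coe_insert, Finset.coe_singleton, Set.mem_insert_iff,
      Set.mem_singleton_iff] at hy ⊢
    rcases hy with rfl | rfl
    · exact absurd hyt hat
    · rfl
  rw [convexHull_singleton, Set.mem_singleton_iff, midpoint_eq_right_iff] at h2
  exact hab h2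

theorem cross_le_zero_of_mem {a b c x : Plane} (h : cross (b - a) (c - a) ≤ 0)
    (hx : x ∈ convexHull ℝ ({a, b, c} : Set Plane)) : cross (b - a) (x - a) ≤ 0 := by
  have hconv : Convex ℝ {y : Plane | cross (b - a) (y - a) ≤ 0} := by
    intro y hy z hz r s hr hs hrs
    simp only [Set.mem_ofPred_eq, cross, PiLp.sub_apply, PiLp.add_apply, PiLp.smul_apply,
      smul_eq_mul] at *
    obtain rfl : s = 1 - r := by linarith
    nlinarith [mul_nonpos_of_nonneg_of_nonpos hr hy, mul_nonpos_of_nonneg_of_nonpos hs hz]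
  refine convexHull_min ?_ hconv hx
  rintro y (rfl | rfl | rfl)
  · simp [cross]
  · simp only [Set.mem_ofPred_eq, cross]; linarith
  · exact h

/-- Step off the midpoint slightly along the left normal n of b - a. The new point is still in Ω, so
some triangle contains it. Triangles are closed and finitely many, so for a small step this triangle
also contains the midpoint, hence the whole edge. A point strictly to the left of ab forces its
third vertex to the left as well. -/
theorem exists_orient_pos (ho : IsOpen Ω) {s : Finset Plane} (hs : s ∈ 𝒯.triangles) {a b : Plane}
    (ha : a ∈ s) (hb : b ∈ s) (hab : a ≠ b) (hm : midpoint ℝ a b ∈ Ω) :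
    ∃ t ∈ 𝒯.triangles, a ∈ t ∧ b ∈ t ∧ 0 < orient t a b := by
  classical
  have hev : ∀ᶠ x in 𝓝 (midpoint ℝ a b), x ∈ Ω ∧ ∀ t ∈ 𝒯.triangles,
      midpoint ℝ a b ∉ convexHull ℝ (t : Set Plane) → x ∉ convexHull ℝ (t : Set Plane) := by
    refine (ho.eventually_mem hm).and ?_
    rw [Filter.eventually_all_finset]
    intro t _
    by_cases h : midpoint ℝ a b ∈ convexHull ℝ (t : Set Plane)
    · simp [h]
    · filter_upwards [(t.finite_toSet.isCompact_convexHull ℝ).isClosed.isOpen_compl.eventually_mem h]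
        with x hx _ using hx
  let n : Plane := !₂[-(b 1 - a 1), b 0 - a 0]
  have hcont : Continuous fun r : ℝ => midpoint ℝ a b + r • n := by fun_prop
  have htend : Tendsto (fun r : ℝ => midpoint ℝ a b + r • n) (𝓝[>] 0) (𝓝 (midpoint ℝ a b)) := by
    have := hcont.tendsto 0
    simp only [zero_smul, add_zero] at this
    exact this.mono_left nhdsWithin_le_nhds
  obtain ⟨r, ⟨hrΩ, hrt⟩, hr⟩ := ((htend.eventually hev).and self_mem_nhdsWithin).exists
  obtain ⟨t, ht, hxt⟩ := 𝒯.mem_closure_iff.1 (subset_closure hrΩ)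
  have hmt : midpoint ℝ a b ∈ convexHull ℝ (t : Set Plane) := by
    by_contra h
    exact hrt t ht h hxt
  have hat := 𝒯.mem_of_midpoint_mem hs ht ha hb hab hmt
  have hbt := 𝒯.mem_of_midpoint_mem hs ht hb ha hab.symm (by rwa [midpoint_comm])
  refine ⟨t, ht, hat, hbt, ?_⟩
  obtain ⟨c, rfl, hac, hbc⟩ := exists_third (𝒯.mem_triangles.1 ht).2 hat hbt hab
  rw [orient_triple hab hac hbc]
  by_contra! hle
  have hx := cross_le_zero_of_mem hle (by simpa using hxt)
  have hne := sq_add_sq_pos hab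
  have heq : cross (b - a) (midpoint ℝ a b + r • n - a) =
      r * ((b 0 - a 0) ^ 2 + (b 1 - a 1) ^ 2) := by
    rw [midpoint_eq_smul_add]
    simp [cross, n]
    ring
  rw [heq] at hx
  have : 0 < r := hr
  nlinarith [mul_pos this hne]

/-- Two distinct triangles on the same side of ab would share a point x near the midpoint but
strictly off the line ab, whereas conformity confines their intersection to the edge. -/
theorem orient_pos_unique {s t : Finset Plane} (hs : s ∈ 𝒯.triangles) (ht : t ∈ 𝒯.triangles)
    {a b : Plane} (has : a ∈ s) (hbs : b ∈ s) (hat : a ∈ t) (hbt : b ∈ t) (hab : a ≠ b)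
    (hos : 0 < orient s a b) (hot : 0 < orient t a b) : s = t := by
  classical
  obtain ⟨c, rfl, hac, hbc⟩ := exists_third (𝒯.mem_triangles.1 hs).2 has hbs hab
  obtain ⟨d, rfl, had, hbd⟩ := exists_third (𝒯.mem_triangles.1 ht).2 hat hbt hab
  rw [orient_triple hab hac hbc] at hos
  rw [orient_triple hab had hbd] at hot
  by_contra hne
  have hcd : c ≠ d := fun h => hne (by rw [h])
  set D := cross (b - a) (c - a) with hD
  -- Cramer's rule: d = a + p (b - a) + q (c - a), and q > 0 since c and d lie on the same side.
  set p := cross (d - a) (c - a) / D with hp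
  set q := cross (b - a) (d - a) / D with hq
  have hq0 : 0 < q := div_pos hot hos
  -- Small enough for the barycentric coordinates of x with respect to a, b, c, namely (1 - η)/2 +
  -- η(1 - p - q), (1 - η)/2 + ηp and ηq, to be nonnegative.
  set η := 1 / (2 * (1 + |p| + |p + q|)) with hη
  have hden : 0 < 2 * (1 + |p| + |p + q|) := by positivity
  have hη0 : 0 < η := by positivity
  have hη1 : η * (2 * (1 + |p| + |p + q|)) = 1 := by rw [hη]; field_simp
  have hηp : 0 ≤ η * |p| := by positivity
  have hηq : 0 ≤ η * |p + q| := by positivity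
  have hp1 : -(η * |p|) ≤ η * p := by nlinarith [neg_abs_le p]
  have hp2 : η * (p + q) ≤ η * |p + q| := by nlinarith [le_abs_self (p + q)]
  set x : Plane := ((1 - η) / 2) • a + ((1 - η) / 2) • b + η • d with hx
  have hη2 : η ≤ 1 / 2 := by nlinarith
  have mem3 : ∀ (e : Plane) (u v w : ℝ), 0 ≤ u → 0 ≤ v → 0 ≤ w → u + v + w = 1 →
      u • a + v • b + w • e ∈ convexHull ℝ ({a, b, e} : Set Plane) := by
    intro e u v w hu hv hw huvw
    have := (convex_convexHull ℝ ({a, b, e} : Set Plane)).sum_mem (t := Finset.univ)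
      (w := ![u, v, w]) (z := ![a, b, e]) (by intro i _; fin_cases i <;> simpa)
      (by simp [Fin.sum_univ_three, huvw])
      (by intro i _; apply subset_convexHull; fin_cases i <;> simp)
    simpa [Fin.sum_univ_three] using this
  have hxt : x ∈ convexHull ℝ ({a, b, d} : Set Plane) :=
    mem3 d _ _ _ (by linarith) (by linarith) hη0.le (by ring)
  have hxs : x ∈ convexHull ℝ ({a, b, c} : Set Plane) := by
    have e : x = ((1 - η) / 2 + η * (1 - p - q)) • a + ((1 - η) / 2 + η * p) • b + (η * q) • c := by
      have hd : ∀ i, d i = a i + p * (b i - a i) + q * (c i - a i) := by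
        intro i
        have hD0 : D ≠ 0 := hos.ne'
        rw [hp, hq]
        field_simp
        rw [hD]
        fin_cases i <;> simp [cross] <;> ring
      ext i
      simp only [hx, PiLp.add_apply, PiLp.smul_apply, smul_eq_mul, hd i]
      ring
    rw [e]
    refine mem3 c _ _ _ ?_ ?_ (by positivity) (by ring) <;> nlinarith
  have hint := 𝒯.inter_subset_convexHull (𝒯.mem_triangles.1 hs).1 (𝒯.mem_triangles.1 ht).1
    ⟨by simpa using hxs, by simpa using hxt⟩
  -- The edge is written as a degenerate triangle so that `cross_le_zero_of_mem` applies to it.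
  have hint2 : x ∈ convexHull ℝ ({a, b, a} : Set Plane) := by
    refine convexHull_mono ?_ hint
    rintro y ⟨hy, hy'⟩
    simp only [Finset.coe_insert, Finset.coe_singleton, Set.mem_insert_iff,
      Set.mem_singleton_iff] at hy hy' ⊢
    rcases hy with h | h | h
    · exact Or.inl h
    · exact Or.inr (Or.inl h)
    · rcases hy' with h' | h' | h'
      · exact Or.inl h'
      · exact Or.inr (Or.inl h')
      · exact absurd (h.symm.trans h') hcd
  have hle := cross_le_zero_of_mem (by simp [cross]) hint2
  have heq : cross (b - a) (x - a) = η * cross (b - a) (d - a) := by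
    simp only [hx, cross, PiLp.sub_apply, PiLp.add_apply, PiLp.smul_apply, smul_eq_mul]
    ring
  rw [heq] at hle
  nlinarith [mul_pos hη0 hot]

/-- The two triangles at an interior edge have opposite orientations. -/
theorem sum_sign_orient (ho : IsOpen Ω) {s : Finset Plane} (hs : s ∈ 𝒯.triangles) {a b : Plane}
    (ha : a ∈ s) (hb : b ∈ s) (hab : a ≠ b) (hm : midpoint ℝ a b ∈ Ω) :
    ∑ t ∈ 𝒯.triangles with a ∈ t ∧ b ∈ t, ((SignType.sign (orient t a b) : SignType) : ℝ) = 0 := by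
  classical
  obtain ⟨t, ht, hat, hbt, hot⟩ := 𝒯.exists_orient_pos ho hs ha hb hab hm
  obtain ⟨t', ht', hbt', hat', hot'⟩ :=
    𝒯.exists_orient_pos ho hs hb ha hab.symm (by rwa [midpoint_comm])
  have hneg : orient t' a b < 0 := by
    rw [orient_swap (𝒯.mem_triangles.1 ht').2 hbt' hat']; linarith
  have htt : t ≠ t' := by rintro rfl; linarith
  have hset : 𝒯.triangles.filter (fun t => a ∈ t ∧ b ∈ t) = {t, t'} := by
    ext u
    simp only [Finset.mem_filter, Finset.mem_insert, Finset.mem_singleton]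
    constructor
    · rintro ⟨hu, hau, hbu⟩
      rcases lt_or_gt_of_ne (𝒯.orient_ne_zero hu hau hbu hab) with h | h
      · right
        refine 𝒯.orient_pos_unique hu ht' hbu hau hbt' hat' hab.symm ?_ hot'
        rw [orient_swap (𝒯.mem_triangles.1 hu).2 hau hbu]; linarith
      · left
        exact 𝒯.orient_pos_unique hu ht hau hbu hat hbt hab h hot
    · rintro (rfl | rfl)
      · exact ⟨ht, hat, hbt⟩
      · exact ⟨ht', hat', hbt'⟩
  rw [hset, Finset.sum_pair htt, sign_pos hot, sign_neg hneg]
  simp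

/-- The oriented sum of `cross (W a) (W b)` over the edges of all triangles vanishes when `W` is
normal to the boundary. -/
theorem sum_cross_eq_zero (ho : IsOpen Ω) (hc : Convex ℝ Ω) {W : Fin 2 → Plane → ℝ}
    (hW : TangentialTraceZero Ω W) :
    ∑ t ∈ 𝒯.triangles, ∑ a ∈ t, ∑ b ∈ t,
      (W 0 a * W 1 b - W 1 a * W 0 b) * ((SignType.sign (orient t a b) : SignType) : ℝ) = 0 := by
  classical
  -- With both vertices ranging over all nodes the sums can be exchanged; for fixed (a, b) the sum
  -- over triangles then involves only the orientation signs.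
  have h1 : ∀ t ∈ 𝒯.triangles, ∑ a ∈ t, ∑ b ∈ t,
      (W 0 a * W 1 b - W 1 a * W 0 b) * ((SignType.sign (orient t a b) : SignType) : ℝ) =
      ∑ a ∈ 𝒯.nodes, ∑ b ∈ 𝒯.nodes, if a ∈ t ∧ b ∈ t then
        (W 0 a * W 1 b - W 1 a * W 0 b) * ((SignType.sign (orient t a b) : SignType) : ℝ) else 0 := by
    intro t ht
    have hsub : t ⊆ 𝒯.nodes := fun a ha => 𝒯.mem_nodes_of_mem ht ha
    rw [← Finset.sum_subset hsub (by intro a _ ha; simp [ha])]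
    refine Finset.sum_congr rfl fun a ha => ?_
    rw [← Finset.sum_subset hsub (by intro b _ hb; simp [hb])]
    exact Finset.sum_congr rfl fun b hb => by simp [ha, hb]
  rw [Finset.sum_congr rfl h1, Finset.sum_comm]
  refine Finset.sum_eq_zero fun a _ => ?_
  rw [Finset.sum_comm]
  refine Finset.sum_eq_zero fun b _ => ?_
  rw [← Finset.sum_filter, ← Finset.mul_sum]
  by_cases hab : a = b
  · subst hab
    rw [mul_comm (W 0 a), sub_self, zero_mul]
  by_cases hex : ∃ s ∈ 𝒯.triangles, a ∈ s ∧ b ∈ s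
  · obtain ⟨s, hs, has, hbs⟩ := hex
    by_cases hm : midpoint ℝ a b ∈ Ω
    · rw [𝒯.sum_sign_orient ho hs has hbs hab hm, mul_zero]
    · have hseg := edge_subset_frontier ho hc (𝒯.mem_closure_of_mem hs has)
        (𝒯.mem_closure_of_mem hs hbs) hm
      have ha := hW a b hseg a (left_mem_segment ℝ a b)
      have hb := hW a b hseg b (right_mem_segment ℝ a b)
      rw [Fin.sum_univ_two] at ha hb
      -- W(a) and W(b) are both orthogonal to b - a. If they were not parallel, they would span the
      -- plane and force b = a.
      have h0 : W 0 a * W 1 b - W 1 a * W 0 b = 0 := by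
        have k0 : (b 0 - a 0) * (W 0 a * W 1 b - W 1 a * W 0 b) = 0 := by
          linear_combination W 1 b * ha - W 1 a * hb
        have k1 : (b 1 - a 1) * (W 0 a * W 1 b - W 1 a * W 0 b) = 0 := by
          linear_combination W 0 a * hb - W 0 b * ha
        by_contra hne
        apply hab
        have j0 := (mul_eq_zero.1 k0).resolve_right hne
        have j1 := (mul_eq_zero.1 k1).resolve_right hne
        ext i
        fin_cases i <;> simp <;> linarith
      rw [h0, zero_mul]
  · rw [Finset.filter_eq_empty_iff.2 fun t ht h => hex ⟨t, ht, h⟩, Finset.sum_empty, mul_zero]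

/-! ### Integration over the triangles -/

/-- By conformity the intersection lies in the affine span of at most two common vertices, a proper
subspace of the plane. -/
theorem aedisjoint {s t : Finset Plane} (hs : s ∈ 𝒯.triangles) (ht : t ∈ 𝒯.triangles)
    (hst : s ≠ t) :
    volume (convexHull ℝ (s : Set Plane) ∩ convexHull ℝ (t : Set Plane)) = 0 := by
  classical
  obtain ⟨hsf, hsc⟩ := 𝒯.mem_triangles.1 hs
  obtain ⟨htf, htc⟩ := 𝒯.mem_triangles.1 ht
  refine measure_mono_null ((𝒯.inter_subset_convexHull hsf htf).trans
    (convexHull_subset_affineSpan _)) ?_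
  refine Measure.addHaar_affineSubspace _ _ fun htop => ?_
  have hcard : (s ∩ t).card ≤ 2 := by
    by_contra! h
    have h1 : s ∩ t = s := Finset.eq_of_subset_of_card_le Finset.inter_subset_left (by omega)
    have h2 : s ∩ t = t := Finset.eq_of_subset_of_card_le Finset.inter_subset_right (by omega)
    exact hst (h1.symm.trans h2)
  rw [← Finset.coe_inter] at htop
  have h3 : Module.finrank ℝ (vectorSpan ℝ ((s ∩ t : Finset Plane) : Set Plane)) = 2 := by
    rw [← direction_affineSpan, htop, AffineSubspace.direction_top, finrank_top]
    simp
  have hne : (s ∩ t).Nonempty := by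
    rw [Finset.nonempty_iff_ne_empty]
    intro h
    rw [h] at htop
    simp at htop
  have hpos := hne.card_pos
  have h4 := finrank_vectorSpan_image_finset_le ℝ (id : Plane → Plane) (s ∩ t)
    (n := (s ∩ t).card - 1) (by omega)
  rw [Finset.image_id, h3] at h4
  omega

theorem ae_eq_iUnion (hc : Convex ℝ Ω) :
    Ω =ᵐ[volume] ⋃ t : 𝒯.triangles, convexHull ℝ (t.1 : Set Plane) := by
  have hU : closure Ω = ⋃ t : 𝒯.triangles, convexHull ℝ (t.1 : Set Plane) := by
    ext x
    simp [𝒯.mem_closure_iff]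
  rw [← hU]
  exact (closure_ae_eq_of_null_frontier (hc.addHaar_frontier volume)).symm

theorem sum_integral (hc : Convex ℝ Ω) {F : Plane → ℝ} (hF : IntegrableOn F Ω) :
    ∑ t ∈ 𝒯.triangles, ∫ x in convexHull ℝ (t : Set Plane), F x = ∫ x in Ω, F x := by
  have hae := 𝒯.ae_eq_iUnion hc
  rw [setIntegral_congr_set hae, integral_iUnion_ae, tsum_fintype,
    ← Finset.sum_coe_sort 𝒯.triangles]
  · exact fun t => (t.1.finite_toSet.isCompact_convexHull ℝ).isClosed.measurableSet.nullMeasurableSet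
  · exact fun s t hst => 𝒯.aedisjoint s.2 t.2 fun h => hst (Subtype.ext h)
  · exact hF.congr_set_ae hae.symm

theorem ae_mem_interior (hc : Convex ℝ Ω) :
    ∀ᵐ x ∂(volume.restrict Ω), ∃ t ∈ 𝒯.triangles, x ∈ interior (convexHull ℝ (t : Set Plane)) := by
  rw [Measure.restrict_congr_set (𝒯.ae_eq_iUnion hc), ae_restrict_iUnion_iff]
  intro t
  have hfr : ∀ᵐ x, x ∉ frontier (convexHull ℝ (t.1 : Set Plane)) :=
    measure_eq_zero_iff_ae_notMem.1 ((convex_convexHull ℝ _).addHaar_frontier volume)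
  have hcl := (t.1.finite_toSet.isCompact_convexHull ℝ).isClosed
  rw [ae_restrict_iff' hcl.measurableSet]
  filter_upwards [hfr] with x hx hxt
  refine ⟨t.1, t.2, ?_⟩
  by_contra h
  exact hx (by rw [hcl.frontier_eq]; exact ⟨hxt, h⟩)

/-! ### Finite element functions -/

theorem add_mem_feSpace {v w : Plane → ℝ} (hv : v ∈ 𝒯.feSpace) (hw : w ∈ 𝒯.feSpace) :
    v + w ∈ 𝒯.feSpace := by
  refine ⟨hv.1.add hw.1, fun t ht => ?_, fun x hx => ?_⟩
  · obtain ⟨l, hl⟩ := hv.2.1 t ht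
    obtain ⟨m, hm⟩ := hw.2.1 t ht
    exact ⟨l + m, fun x hx => by simp [hl hx, hm hx]⟩
  · simp [hv.2.2 x hx, hw.2.2 x hx]

theorem smul_mem_feSpace (r : ℝ) {v : Plane → ℝ} (hv : v ∈ 𝒯.feSpace) : r • v ∈ 𝒯.feSpace := by
  refine ⟨hv.1.const_smul r, fun t ht => ?_, fun x hx => ?_⟩
  · obtain ⟨l, hl⟩ := hv.2.1 t ht
    exact ⟨r • l, fun x hx => by simp [hl hx]⟩
  · simp [hv.2.2 x hx]

theorem zero_mem_feSpace : (0 : Plane → ℝ) ∈ 𝒯.feSpace :=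
  ⟨continuousOn_const, fun _ _ => ⟨0, fun x _ => by simp⟩, fun _ _ => rfl⟩

theorem shape_mem_feSpace (z : Plane) : 𝒯.shape z ∈ 𝒯.feSpace := by
  classical
  exact (𝒯.existsUnique_nodal fun y => if y = z then 1 else 0).choose_spec.1.1

theorem sum_mem_feSpace {ι : Type*} (s : Finset ι) (v : ι → Plane → ℝ)
    (hv : ∀ i ∈ s, v i ∈ 𝒯.feSpace) : ∑ i ∈ s, v i ∈ 𝒯.feSpace :=
  Finset.sum_induction _ (· ∈ 𝒯.feSpace) (fun _ _ => 𝒯.add_mem_feSpace) 𝒯.zero_mem_feSpace hv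

variable {𝒯}

theorem eq_zero_of_nodes {v : Plane → ℝ} (hv : v ∈ 𝒯.feSpace) (h : ∀ z ∈ 𝒯.nodes, v z = 0) :
    v = 0 :=
  (𝒯.existsUnique_nodal 0).unique ⟨hv, h⟩ ⟨𝒯.zero_mem_feSpace, fun _ _ => rfl⟩

theorem hasFDerivAt_of_eqOn {v : Plane → ℝ} {l : Plane →ᵃ[ℝ] ℝ} {t : Finset Plane}
    (h : Set.EqOn v l (convexHull ℝ (t : Set Plane))) {x : Plane}
    (hx : x ∈ interior (convexHull ℝ (t : Set Plane))) :
    HasFDerivAt v (LinearMap.toContinuousLinearMap l.linear) x := by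
  have hl : HasFDerivAt l (LinearMap.toContinuousLinearMap l.linear) x := by
    rw [l.decomp]
    exact (LinearMap.toContinuousLinearMap l.linear).hasFDerivAt.add_const (l 0)
  refine hl.congr_of_eventuallyEq ?_
  filter_upwards [isOpen_interior.mem_nhds hx] with y hy using h (interior_subset hy)

theorem partialDeriv_of_eqOn {v : Plane → ℝ} {l : Plane →ᵃ[ℝ] ℝ} {t : Finset Plane}
    (h : Set.EqOn v l (convexHull ℝ (t : Set Plane))) {x : Plane}
    (hx : x ∈ interior (convexHull ℝ (t : Set Plane))) (i : Fin 2) :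
    partialDeriv i v x = l.linear (EuclideanSpace.single i 1) := by
  rw [partialDeriv, (hasFDerivAt_of_eqOn h hx).fderiv]
  rfl

theorem ae_differentiableAt (hc : Convex ℝ Ω) {v : Plane → ℝ} (hv : v ∈ 𝒯.feSpace) :
    ∀ᵐ x ∂(volume.restrict Ω), DifferentiableAt ℝ v x := by
  filter_upwards [𝒯.ae_mem_interior hc] with x ⟨t, ht, hx⟩
  obtain ⟨l, hl⟩ := hv.2.1 t ht
  exact (hasFDerivAt_of_eqOn hl hx).differentiableAt

theorem measurable_partialDeriv (i : Fin 2) (v : Plane → ℝ) : Measurable (partialDeriv i v) :=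
  measurable_fderiv_apply_const ℝ v _

theorem memLp_partialDeriv (hc : Convex ℝ Ω) (i : Fin 2) {v : Plane → ℝ} (hv : v ∈ 𝒯.feSpace) :
    MemLp (partialDeriv i v) ⊤ (volume.restrict Ω) := by
  choose! l hl using hv.2.1
  refine memLp_top_of_bound (measurable_partialDeriv i v).aestronglyMeasurable
    (∑ t ∈ 𝒯.triangles, |(l t).linear (EuclideanSpace.single i 1)|) ?_
  filter_upwards [𝒯.ae_mem_interior hc] with x ⟨t, ht, hx⟩
  rw [partialDeriv_of_eqOn (hl t ht) hx, Real.norm_eq_abs]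
  exact Finset.single_le_sum (f := fun t => |(l t).linear (EuclideanSpace.single i 1)|)
    (fun _ _ => abs_nonneg _) ht

theorem memLp_of_mem_feSpace (hb : Bornology.IsBounded Ω) (ho : IsOpen Ω)
    {v : Plane → ℝ} (hv : v ∈ 𝒯.feSpace) : MemLp v ⊤ (volume.restrict Ω) := by
  obtain ⟨M, hM⟩ := (hb.isCompact_closure.exists_bound_of_continuousOn hv.1)
  refine memLp_top_of_bound ((hv.1.mono subset_closure).aestronglyMeasurable ho.measurableSet) M ?_
  filter_upwards [ae_restrict_mem ho.measurableSet] with x hx using hM x (subset_closure hx)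

/-- A continuous piecewise affine field that is normal to the boundary of a convex polygon has
vanishing integrated Jacobian determinant. -/
theorem integral_det_jac (ho : IsOpen Ω) (hc : Convex ℝ Ω) (hb : Bornology.IsBounded Ω)
    {W : Fin 2 → Plane → ℝ} (hW : ∀ i, W i ∈ 𝒯.feSpace) (hT : TangentialTraceZero Ω W) :
    ∫ x in Ω, (partialDeriv 0 (W 0) x * partialDeriv 1 (W 1) x -
      partialDeriv 1 (W 0) x * partialDeriv 0 (W 1) x) = 0 := by
  have : IsFiniteMeasure (volume.restrict Ω) := ⟨by simpa using hb.measure_lt_top⟩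
  have hprod : ∀ i j k m : Fin 2, Integrable
      (fun x => partialDeriv i (W j) x * partialDeriv k (W m) x) (volume.restrict Ω) := by
    intro i j k m
    have h := (memLp_partialDeriv hc k (hW m)).mul (memLp_partialDeriv hc i (hW j)) (r := ⊤)
    exact h.integrable le_top
  rw [← 𝒯.sum_integral hc (by exact (hprod 0 0 1 1).sub (hprod 1 0 0 1))]
  have hterm : ∀ t ∈ 𝒯.triangles, ∫ x in convexHull ℝ (t : Set Plane),
      (partialDeriv 0 (W 0) x * partialDeriv 1 (W 1) x -
        partialDeriv 1 (W 0) x * partialDeriv 0 (W 1) x) =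
      refArea / 2 * ∑ a ∈ t, ∑ b ∈ t,
        (W 0 a * W 1 b - W 1 a * W 0 b) * ((SignType.sign (orient t a b) : SignType) : ℝ) := by
    intro t ht
    obtain ⟨l, hl⟩ := (hW 0).2.1 t ht
    obtain ⟨m, hm⟩ := (hW 1).2.1 t ht
    have hlv : ∀ a ∈ t, W 0 a = l a := fun a ha => hl (subset_convexHull ℝ _ ha)
    have hmv : ∀ a ∈ t, W 1 a = m a := fun a ha => hm (subset_convexHull ℝ _ ha)
    have hsum : ∑ a ∈ t, ∑ b ∈ t,
        (W 0 a * W 1 b - W 1 a * W 0 b) * ((SignType.sign (orient t a b) : SignType) : ℝ) =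
        ∑ a ∈ t, ∑ b ∈ t,
        (l a * m b - m a * l b) * ((SignType.sign (orient t a b) : SignType) : ℝ) :=
      Finset.sum_congr rfl fun a ha => Finset.sum_congr rfl fun b hb => by
        rw [hlv a ha, hlv b hb, hmv a ha, hmv b hb]
    rw [hsum, ← area_mul_det (𝒯.mem_triangles.1 ht).2]
    -- On the interior the derivatives are those of l and m, so the integrand is constant there; the
    -- boundary of the triangle is null.
    have hfr := interior_ae_eq_of_null_frontier
      ((convex_convexHull ℝ (t : Set Plane)).addHaar_frontier volume)
    rw [← setIntegral_congr_set hfr, setIntegral_congr_fun isOpen_interior.measurableSet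
      (g := fun _ => l.linear (EuclideanSpace.single 0 1) * m.linear (EuclideanSpace.single 1 1) -
        l.linear (EuclideanSpace.single 1 1) * m.linear (EuclideanSpace.single 0 1))]
    · rw [setIntegral_const, smul_eq_mul, measureReal_def, measure_congr hfr]
    · intro x hx
      simp only [partialDeriv_of_eqOn hl hx, partialDeriv_of_eqOn hm hx]
  rw [Finset.sum_congr rfl hterm, ← Finset.mul_sum, 𝒯.sum_cross_eq_zero ho hc hT, mul_zero]

end Triangulation

/-! ### Pointwise estimates -/

theorem frob_eq (A B : Matrix (Fin 2) (Fin 2) ℝ) :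
    frob A B = A 0 0 * B 0 0 + A 0 1 * B 0 1 + A 1 0 * B 1 0 + A 1 1 * B 1 1 := by
  simp only [frob, Fin.sum_univ_two]; ring

/-- Entrywise consequences of uniform ellipticity of a symmetric matrix. -/
theorem elliptic_entries {α β : ℝ} {A : Matrix (Fin 2) (Fin 2) ℝ}
    (hA : ∀ ξ : Fin 2 → ℝ,
      α * (ξ ⬝ᵥ ξ) ≤ ξ ⬝ᵥ A.mulVec ξ ∧ ξ ⬝ᵥ A.mulVec ξ ≤ β * (ξ ⬝ᵥ ξ)) (hs : A.IsSymm) :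
    A 1 0 = A 0 1 ∧ α ≤ A 0 0 ∧ α ≤ A 1 1 ∧ A 0 0 ≤ β ∧ A 1 1 ≤ β ∧
      A 0 1 ^ 2 ≤ (A 0 0 - α) * (A 1 1 - α) ∧ A 0 1 ^ 2 ≤ (β - A 0 0) * (β - A 1 1) := by
  have h10 : A 1 0 = A 0 1 := hs.apply 0 1
  have key : ∀ x y : ℝ, α * (x * x + y * y) ≤ A 0 0 * x * x + 2 * A 0 1 * x * y + A 1 1 * y * y ∧
      A 0 0 * x * x + 2 * A 0 1 * x * y + A 1 1 * y * y ≤ β * (x * x + y * y) := by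
    intro x y
    have h := hA ![x, y]
    simp only [dotProduct, Matrix.mulVec, Fin.sum_univ_two, Matrix.cons_val_zero,
      Matrix.cons_val_one, h10] at h
    constructor <;> nlinarith [h.1, h.2]
  have k1 := key 1 0
  have k2 := key 0 1
  refine ⟨h10, by linarith [k1.1], by linarith [k2.1], by linarith [k1.2], by linarith [k2.2], ?_, ?_⟩
  -- The quadratic form of A - αI at (x, 1) is a nonnegative polynomial in x, so its discriminant is
  -- not positive.
  · have h := discrim_le_zero (a := A 0 0 - α) (b := 2 * A 0 1) (c := A 1 1 - α)
      fun x => by nlinarith [(key x 1).1]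
    rw [discrim] at h
    nlinarith
  · have h := discrim_le_zero (a := β - A 0 0) (b := -2 * A 0 1) (c := β - A 1 1)
      fun x => by nlinarith [(key x 1).2]
    rw [discrim] at h
    nlinarith

/-- The eigenvalues of A lie in [α, β]. In entries, |A|² ≤ 2β² - T(2β - T) with T = tr A between 0
and 2β. -/
theorem frob_self_le {α β : ℝ} (hα : 0 < α) {A : Matrix (Fin 2) (Fin 2) ℝ}
    (hA : ∀ ξ : Fin 2 → ℝ,
      α * (ξ ⬝ᵥ ξ) ≤ ξ ⬝ᵥ A.mulVec ξ ∧ ξ ⬝ᵥ A.mulVec ξ ≤ β * (ξ ⬝ᵥ ξ)) (hs : A.IsSymm) :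
    frob A A ≤ 2 * β ^ 2 := by
  obtain ⟨h10, ha, hd, ha', hd', -, hb⟩ := elliptic_entries hA hs
  rw [frob_eq, h10]
  nlinarith [mul_nonneg (add_nonneg (hα.le.trans ha) (hα.le.trans hd))
    (add_nonneg (sub_nonneg.2 ha') (sub_nonneg.2 hd'))]

/-- Cauchy–Schwarz by Lagrange's identity: the difference is the sum of the squares of the six
minors. -/
theorem frob_sq_le (A B : Matrix (Fin 2) (Fin 2) ℝ) : frob A B ^ 2 ≤ frob A A * frob B B := by
  simp only [frob_eq]
  nlinarith [sq_nonneg (A 0 0 * B 0 1 - A 0 1 * B 0 0), sq_nonneg (A 0 0 * B 1 0 - A 1 0 * B 0 0),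
    sq_nonneg (A 0 0 * B 1 1 - A 1 1 * B 0 0), sq_nonneg (A 0 1 * B 1 0 - A 1 0 * B 0 1),
    sq_nonneg (A 0 1 * B 1 1 - A 1 1 * B 0 1), sq_nonneg (A 1 0 * B 1 1 - A 1 1 * B 1 0)]

theorem frob_self_nonneg (A : Matrix (Fin 2) (Fin 2) ℝ) : 0 ≤ frob A A := by
  rw [frob_eq]
  nlinarith [sq_nonneg (A 0 0), sq_nonneg (A 0 1), sq_nonneg (A 1 0), sq_nonneg (A 1 1)]

/-- The Cordes perturbation argument, pointwise: up to a multiple of the null Lagrangian `det D`,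
the full matrix `D` is controlled by `A : D` and the antisymmetric part of `D`. -/
theorem cordes_pointwise {α β : ℝ} (hα : 0 < α) (hβ : 0 < β) {A : Matrix (Fin 2) (Fin 2) ℝ}
    (hA : ∀ ξ : Fin 2 → ℝ,
      α * (ξ ⬝ᵥ ξ) ≤ ξ ⬝ᵥ A.mulVec ξ ∧ ξ ⬝ᵥ A.mulVec ξ ≤ β * (ξ ⬝ᵥ ξ)) (hs : A.IsSymm)
    (D : Matrix (Fin 2) (Fin 2) ℝ) :
    (α ^ 2 / β ^ 2) ^ 2 * frob D D + 2 * (D 0 0 * D 1 1 - D 1 0 * D 0 1) ≤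
      (1 + 1 / (α ^ 2 / β ^ 2)) * (β / α ^ 2) ^ 2 * frob A D ^ 2 + (D 1 0 - D 0 1) ^ 2 := by
  obtain ⟨h10, ha, hd, ha', hd', hb, -⟩ := elliptic_entries hA hs
  have hN2 := frob_self_le hα hA hs
  set N := frob A A with hN
  set T := A 0 0 + A 1 1 with hT
  -- From T² = N + 2 det A with det A ≥ α² and N ≤ 2β² it follows that T²/N ≥ 1 + ρ.
  set ρ := α ^ 2 / β ^ 2 with hρ
  have hρ0 : 0 < ρ := by positivity
  have hT1 : 2 * α ≤ T := by linarith
  have hT2 : T ≤ 2 * β := by linarith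
  have hNe : N = A 0 0 ^ 2 + 2 * A 0 1 ^ 2 + A 1 1 ^ 2 := by rw [hN, frob_eq, h10]; ring
  have hNT : N = T ^ 2 - 2 * (A 0 0 * A 1 1 - A 0 1 ^ 2) := by rw [hNe, hT]; ring
  have hdet : α ^ 2 ≤ A 0 0 * A 1 1 - A 0 1 ^ 2 := by nlinarith
  have hN1 : 2 * α ^ 2 ≤ N := by
    rw [hNe]; nlinarith [sq_nonneg (A 0 1)]
  have hN0 : 0 < N := lt_of_lt_of_le (by positivity) hN1
  -- The minimizer of |γA - I|² = γ²N - 2γT + 2, whose minimum is 2 - T²/N ≤ 1 - ρ.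
  set γ := T / N with hγ
  have hγN : γ * N = T := by rw [hγ]; field_simp
  have hγ0 : 0 ≤ γ := by
    apply div_nonneg _ hN0.le
    linarith
  have hγ1 : γ ≤ β / α ^ 2 := by
    rw [hγ, div_le_div_iff₀ hN0 (by positivity)]
    nlinarith [mul_le_mul hT2 le_rfl (sq_nonneg α) (by positivity), mul_le_mul_of_nonneg_left hN1 hβ.le]
  have hγT : 1 + ρ ≤ γ * T := by
    have h1 : ρ * N ≤ 2 * α ^ 2 := by
      rw [hρ, div_mul_eq_mul_div, div_le_iff₀ (by positivity)]
      nlinarith [mul_le_mul_of_nonneg_left hN2 (sq_nonneg α)]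
    have h2 : (1 + ρ) * N ≤ T * T := by nlinarith
    rw [hγ, div_mul_eq_mul_div, le_div_iff₀ hN0]
    exact h2
  let B : Matrix (Fin 2) (Fin 2) ℝ := γ • A - 1
  have hBB : frob B B ≤ 1 - ρ := by
    have : frob B B = γ * (γ * N) - 2 * (γ * T) + 2 := by
      rw [frob_eq, hNe, hT]
      simp [B, h10]
      ring
    rw [this, hγN]
    linarith
  have hdiv : D 0 0 + D 1 1 = γ * frob A D - frob B D := by
    rw [frob_eq, frob_eq]
    simp [B]
    ring
  have hY : frob B D ^ 2 ≤ (1 - ρ) * frob D D :=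
    (frob_sq_le B D).trans (mul_le_mul_of_nonneg_right hBB (frob_self_nonneg D))
  -- Young's inequality with parameter ρ. Together with `hY` the second term is at most (1 + ρ)(1 -
  -- ρ)|D|² = (1 - ρ²)|D|², which leaves ρ²|D|² on the left.
  have hsq : (D 0 0 + D 1 1) ^ 2 ≤
      (1 + 1 / ρ) * (γ * frob A D) ^ 2 + (1 + ρ) * frob B D ^ 2 := by
    rw [hdiv]
    have : (1 + 1 / ρ) * (γ * frob A D) ^ 2 + (1 + ρ) * frob B D ^ 2 -
        (γ * frob A D - frob B D) ^ 2 = (γ * frob A D + ρ * frob B D) ^ 2 / ρ := by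
      field_simp; ring
    have h2 : 0 ≤ (γ * frob A D + ρ * frob B D) ^ 2 / ρ := by positivity
    linarith
  have hX : (1 + 1 / ρ) * (γ * frob A D) ^ 2 ≤ (1 + 1 / ρ) * (β / α ^ 2) ^ 2 * frob A D ^ 2 := by
    rw [mul_pow, ← mul_assoc]
    gcongr
  have hDD : frob D D = (D 0 0 + D 1 1) ^ 2 + (D 1 0 - D 0 1) ^ 2 -
      2 * (D 0 0 * D 1 1 - D 1 0 * D 0 1) := by
    rw [frob_eq]; ring
  nlinarith [mul_le_mul_of_nonneg_left hY (by positivity : 0 ≤ 1 + ρ)]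

/-! ### Fields with constant components -/

variable {Ω : Set Plane} {𝒯 : Triangulation Ω}

namespace Triangulation

/-- On each triangle v is affine with zero gradient, hence constant. So v takes only finitely many
values, and it is continuous on the connected set closure Ω. -/
theorem exists_const_of_partialDeriv_eq_zero (hc : Convex ℝ Ω) {v : Plane → ℝ}
    (hv : v ∈ 𝒯.feSpace) (h : ∀ᵐ x ∂(volume.restrict Ω), ∀ i, partialDeriv i v x = 0)
    (ho : IsOpen Ω) : ∃ k, ∀ x ∈ closure Ω, v x = k := by
  have htri : ∀ t ∈ 𝒯.triangles, ∀ x ∈ convexHull ℝ (t : Set Plane),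
      ∀ y ∈ convexHull ℝ (t : Set Plane), v x = v y := by
    intro t ht x hx y hy
    obtain ⟨l, hl⟩ := hv.2.1 t ht
    have htop : affineSpan ℝ (t : Set Plane) = ⊤ := by
      have hind := 𝒯.indep (𝒯.mem_triangles.1 ht).1
      have := (hind.affineSpan_eq_top_iff_card_eq_finrank_add_one).2
        (by simp [(𝒯.mem_triangles.1 ht).2])
      simpa using this
    have hne := interior_convexHull_nonempty_iff_affineSpan_eq_top.2 htop
    -- A nonempty open set has positive measure, so the almost everywhere hypothesis holds at one of
    -- its points; one point determines the constant gradient.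
    have hne2 : (interior (convexHull ℝ (t : Set Plane)) ∩ Ω).Nonempty := by
      obtain ⟨z, hz⟩ := hne
      exact _root_.mem_closure_iff.1 (𝒯.convexHull_subset_closure ht (interior_subset hz)) _
        isOpen_interior hz
    have hpos := (isOpen_interior.inter ho).measure_pos volume hne2
    obtain ⟨z, hz, hzv⟩ : ∃ z ∈ interior (convexHull ℝ (t : Set Plane)) ∩ Ω,
        ∀ i, partialDeriv i v z = 0 := by
      by_contra! hcon
      rw [ae_restrict_iff' ho.measurableSet] at h
      refine hpos.ne' (measure_mono_null ?_ h)
      intro z hz hzz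
      obtain ⟨i, hi⟩ := hcon z hz
      exact hi (hzz hz.2 i)
    have h0 := partialDeriv_of_eqOn hl hz.1 0
    have h1 := partialDeriv_of_eqOn hl hz.1 1
    rw [hzv] at h0 h1
    rw [hl hx, hl hy, affine_apply_eq l x y, ← h0, ← h1]
    ring
  have hfin : (v '' closure Ω).Finite := by
    refine (𝒯.nodes.finite_toSet.image v).subset ?_
    rintro _ ⟨x, hx, rfl⟩
    obtain ⟨t, ht, hxt⟩ := 𝒯.mem_closure_iff.1 hx
    obtain ⟨a, ha⟩ : t.Nonempty := Finset.card_pos.1 (by rw [(𝒯.mem_triangles.1 ht).2]; norm_num)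
    exact ⟨a, 𝒯.mem_nodes_of_mem ht ha, htri t ht a (subset_convexHull ℝ _ ha) x hxt⟩
  have hpre := hc.closure.isPreconnected.image v hv.1
  have hsub := hfin.countable.isTotallyDisconnected _ subset_rfl hpre
  by_cases hne : (closure Ω).Nonempty
  · obtain ⟨z, hz⟩ := hne
    exact ⟨v z, fun x hx => hsub ⟨x, hx, rfl⟩ ⟨z, hz, rfl⟩⟩
  · exact ⟨0, fun x hx => absurd ⟨x, hx⟩ hne⟩

/-- The sides of a polygon are not all parallel. -/
theorem const_eq_zero_of_tangentialTraceZero (𝒯 : Triangulation Ω) (ho : IsOpen Ω)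
    (hc : Convex ℝ Ω) (hb : Bornology.IsBounded Ω) (hne : Ω.Nonempty) {W : Fin 2 → Plane → ℝ}
    (hT : TangentialTraceZero Ω W) {k : Fin 2 → ℝ} (hk : ∀ i, ∀ x ∈ closure Ω, W i x = k i) :
    k = 0 := by
  by_contra hk0
  have hk2 : 0 < k 0 ^ 2 + k 1 ^ 2 := by
    by_contra! h
    apply hk0
    ext i
    fin_cases i <;> simp <;> nlinarith [sq_nonneg (k 0), sq_nonneg (k 1)]
  let g : Plane → ℝ := fun x => k 0 * x 0 + k 1 * x 1
  obtain ⟨z, hz⟩ := hne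
  -- The function g = k · x takes infinitely many values on the open set Ω but finitely many at the
  -- nodes, so some level line through Ω misses every node.
  obtain ⟨y, hyΩ, hyg⟩ : ∃ y ∈ Ω, g y ∉ g '' 𝒯.nodes := by
    let n : Plane := !₂[k 0, k 1]
    have hcont : Continuous fun r : ℝ => z + r • n := by fun_prop
    have hev : ∀ᶠ r in 𝓝 (0 : ℝ), z + r • n ∈ Ω :=
      hcont.tendsto 0 (ho.mem_nhds (by simpa using hz))
    have hinf : {r : ℝ | z + r • n ∈ Ω}.Infinite := infinite_of_mem_nhds 0 hev
    have hinj : Function.Injective fun r : ℝ => g (z + r • n) := by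
      intro r s hrs
      simp only [g, n, PiLp.add_apply, PiLp.smul_apply, smul_eq_mul,
        Matrix.cons_val_zero, Matrix.cons_val_one] at hrs
      have : (r - s) * (k 0 ^ 2 + k 1 ^ 2) = 0 := by linear_combination hrs
      exact sub_eq_zero.1 ((mul_eq_zero.1 this).resolve_right hk2.ne')
    obtain ⟨r, hr⟩ := (hinf.sdiff ((𝒯.nodes.finite_toSet.image g).preimage hinj.injOn)).nonempty
    exact ⟨z + r • n, hr.1, hr.2⟩
  -- That level line is unbounded and connected, so it must leave the bounded set Ω through a
  -- boundary point x.
  obtain ⟨x, hxfr, hxg⟩ : ∃ x ∈ frontier Ω, g x = g y := by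
    by_contra! hcon
    let d : Plane := !₂[-k 1, k 0]
    have hcont : Continuous fun r : ℝ => y + r • d := by fun_prop
    have hg : ∀ r : ℝ, g (y + r • d) = g y := by
      intro r; simp [g, d]; ring
    have hpre : IsPreconnected (Set.range fun r : ℝ => y + r • d) := isPreconnected_range hcont
    have hsub : (Set.range fun r : ℝ => y + r • d) ⊆ Ω := by
      refine hpre.subset_left_of_subset_union ho isClosed_closure.isOpen_compl
        (Set.disjoint_compl_right_iff_subset.2 subset_closure) ?_ ⟨y, ⟨0, by simp⟩, hyΩ⟩
      rintro _ ⟨r, rfl⟩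
      by_contra hr
      rw [Set.mem_union, not_or, Set.mem_compl_iff, not_not] at hr
      exact hcon _ (by rw [ho.frontier_eq]; exact ⟨hr.2, hr.1⟩) (hg r)
    obtain ⟨M, hM⟩ := hb.exists_norm_le
    have hd : 0 < ‖d‖ := norm_pos_iff.2 fun h0 => by
      have e0 : d 0 = 0 := by rw [h0]; rfl
      have e1 : d 1 = 0 := by rw [h0]; rfl
      simp only [d, Matrix.cons_val_zero, Matrix.cons_val_one] at e0 e1
      nlinarith
    have h1 := hM _ (hsub ⟨(M + ‖y‖ + 1) / ‖d‖, rfl⟩)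
    have hM0 : 0 ≤ M := (norm_nonneg _).trans (hM y hyΩ)
    have h2 : ‖((M + ‖y‖ + 1) / ‖d‖) • d‖ = M + ‖y‖ + 1 := by
      rw [norm_smul, Real.norm_of_nonneg (by positivity)]
      field_simp
    have h3 := norm_sub_le (y + ((M + ‖y‖ + 1) / ‖d‖) • d) y
    rw [add_sub_cancel_left, h2] at h3
    simp only at h1
    linarith
  obtain ⟨t, ht, hxt⟩ := 𝒯.mem_closure_iff.1 (frontier_subset_closure hxfr)
  obtain ⟨w, hw, hw1, hwx⟩ := Finset.mem_convexHull'.1 hxt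
  have hxΩ : ∑ y ∈ t, w y • y ∉ Ω := by
    rw [hwx]; rw [ho.frontier_eq] at hxfr; exact hxfr.2
  obtain ⟨a, ha, hwa⟩ : ∃ a ∈ t, 0 < w a := Finset.exists_lt_of_sum_lt (by simp [hw1])
  -- Vertices that carry positive weight at x are joined by boundary segments, along which g is
  -- constant because k is normal to them. So g(x) is a nodal value, contrary to the choice of y.
  have hga : ∀ b ∈ t, w b * g b = w b * g a := by
    intro b hbt
    rcases (hw b hbt).eq_or_lt with h | h
    · simp [← h]
    · have hseg := segment_subset_frontier ho hc (fun y hy => 𝒯.mem_closure_of_mem ht hy) hw hw1 hxΩ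
        ha hbt hwa h
      have := hT a b hseg a (left_mem_segment ℝ a b)
      rw [Fin.sum_univ_two, hk 0 a (𝒯.mem_closure_of_mem ht ha),
        hk 1 a (𝒯.mem_closure_of_mem ht ha)] at this
      simp only [g]
      linear_combination w b * this
  have hgx : g x = g a := by
    have e : g x = ∑ b ∈ t, w b * g b := by
      rw [← hwx]
      simp only [g, WithLp.ofLp_sum, Finset.sum_apply, PiLp.smul_apply, smul_eq_mul, Finset.mul_sum,
        ← Finset.sum_add_distrib]
      exact Finset.sum_congr rfl fun b _ => by ring
    rw [e, Finset.sum_congr rfl hga, ← Finset.sum_mul, hw1, one_mul]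
  exact hyg ⟨a, 𝒯.mem_nodes_of_mem ht ha, by rw [← hgx, hxg]⟩

end Triangulation

/-! ### The recovery operator and the space `V_h^{0,0}` -/

namespace Sampling

variable (S : Sampling 𝒯)

theorem fit_spec (v : Plane → ℝ) (z : 𝒯.nodes) : IsQuadraticFit (S.pts z) v (S.fit v z) :=
  (existsUnique_quadraticFit (S.unisolvent z) v).choose_spec.1

/-- The normal equations are linear in the data and uniquely solvable, so the least-squares fit is
linear. -/
theorem fit_add (v w : Plane → ℝ) (z : 𝒯.nodes) : S.fit (v + w) z = S.fit v z + S.fit w z := by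
  refine (existsUnique_quadraticFit (S.unisolvent z) (v + w)).unique (S.fit_spec _ z) ⟨?_, ?_⟩
  · exact add_mem (S.fit_spec v z).1 (S.fit_spec w z).1
  · intro q hq
    have h1 := (S.fit_spec v z).2 q hq
    have h2 := (S.fit_spec w z).2 q hq
    rw [← add_zero (0 : ℝ)]
    nth_rewrite 1 [← h1]
    rw [← h2, ← Finset.sum_add_distrib]
    refine Finset.sum_congr rfl fun x _ => ?_
    simp only [polyVal, map_add, Pi.add_apply]
    ring

theorem fit_smul (r : ℝ) (v : Plane → ℝ) (z : 𝒯.nodes) : S.fit (r • v) z = r • S.fit v z := by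
  refine (existsUnique_quadraticFit (S.unisolvent z) (r • v)).unique (S.fit_spec _ z) ⟨?_, ?_⟩
  · exact Submodule.smul_mem _ r (S.fit_spec v z).1
  · intro q hq
    rw [← mul_zero r, ← (S.fit_spec v z).2 q hq, Finset.mul_sum]
    refine Finset.sum_congr rfl fun x _ => ?_
    simp only [polyVal, MvPolynomial.smul_eval, Pi.smul_apply, smul_eq_mul]
    ring

theorem grad_add (v w : Plane → ℝ) : S.grad (v + w) = S.grad v + S.grad w := by
  ext i x
  simp only [grad, fit_add, map_add, polyVal, Pi.add_apply, add_mul, Finset.sum_add_distrib]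

theorem grad_smul (r : ℝ) (v : Plane → ℝ) : S.grad (r • v) = r • S.grad v := by
  ext i x
  simp only [grad, fit_smul, Derivation.map_smul, polyVal, MvPolynomial.smul_eval, Pi.smul_apply, smul_eq_mul,
    Finset.mul_sum, mul_assoc]

theorem grad_mem_feSpace (v : Plane → ℝ) (i : Fin 2) : S.grad v i ∈ 𝒯.feSpace := by
  have : S.grad v i = ∑ z : 𝒯.nodes,
      polyVal (MvPolynomial.pderiv i (S.fit v z)) z • 𝒯.shape z := by
    ext x
    simp [grad]
  rw [this]
  exact 𝒯.sum_mem_feSpace _ _ fun z _ => 𝒯.smul_mem_feSpace _ (𝒯.shape_mem_feSpace z)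

/-- `V_h^{0,0}` as a linear subspace. -/
def zeroZero : Submodule ℝ (Plane → ℝ) where
  carrier := S.spaceZeroZero
  zero_mem' := by
    refine ⟨⟨𝒯.zero_mem_feSpace, fun _ _ => rfl⟩, fun p q _ x _ => ?_⟩
    rw [← zero_smul ℝ (0 : Plane → ℝ), grad_smul]
    simp
  add_mem' := by
    rintro v w ⟨⟨hv, hv0⟩, hvT⟩ ⟨⟨hw, hw0⟩, hwT⟩
    refine ⟨⟨𝒯.add_mem_feSpace hv hw, fun x hx => by simp [hv0 x hx, hw0 x hx]⟩,
      fun p q hpq x hx => ?_⟩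
    have h1 := hvT p q hpq x hx
    have h2 := hwT p q hpq x hx
    rw [grad_add]
    simp only [Pi.add_apply, add_mul, Finset.sum_add_distrib, h1, h2, add_zero]
  smul_mem' := by
    rintro r v ⟨⟨hv, hv0⟩, hvT⟩
    refine ⟨⟨𝒯.smul_mem_feSpace r hv, fun x hx => by simp [hv0 x hx]⟩, fun p q hpq x hx => ?_⟩
    have h1 := hvT p q hpq x hx
    rw [grad_smul]
    simp only [Pi.smul_apply, smul_eq_mul, mul_assoc, ← Finset.mul_sum, h1, mul_zero]

instance finiteDimensional_zeroZero : FiniteDimensional ℝ S.zeroZero := by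
  let ev : S.zeroZero →ₗ[ℝ] (𝒯.nodes → ℝ) :=
    { toFun := fun v z => v.1 z
      map_add' := fun _ _ => rfl
      map_smul' := fun _ _ => rfl }
  refine FiniteDimensional.of_injective ev ((injective_iff_map_eq_zero ev).2 fun v hv => ?_)
  exact Subtype.ext (Triangulation.eq_zero_of_nodes v.2.1.1 fun z hz => congrFun hv ⟨z, hz⟩)

end Sampling

/-! ### The differential operators on recovered gradients -/

/-- `fderiv` is additive where both functions are differentiable, which holds inside the triangles
and so almost everywhere. Linearity of the form is therefore obtained under the integral. -/
theorem jac_add_ae (hc : Convex ℝ Ω) {V W : Fin 2 → Plane → ℝ} (hV : ∀ i, V i ∈ 𝒯.feSpace)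
    (hW : ∀ i, W i ∈ 𝒯.feSpace) :
    ∀ᵐ x ∂(volume.restrict Ω), jac (V + W) x = jac V x + jac W x := by
  filter_upwards [ae_all_iff.2 fun i => Triangulation.ae_differentiableAt hc (hV i),
    ae_all_iff.2 fun i => Triangulation.ae_differentiableAt hc (hW i)] with x h1 h2
  ext i j
  simp [jac, partialDeriv, fderiv_add (h1 j) (h2 j)]

theorem jac_smul_ae (hc : Convex ℝ Ω) (r : ℝ) {V : Fin 2 → Plane → ℝ}
    (hV : ∀ i, V i ∈ 𝒯.feSpace) :
    ∀ᵐ x ∂(volume.restrict Ω), jac (r • V) x = r • jac V x := by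
  filter_upwards [ae_all_iff.2 fun i => Triangulation.ae_differentiableAt hc (hV i)] with x h1
  ext i j
  simp [jac, partialDeriv, fderiv_const_smul (h1 j)]

theorem rot_eq (W : Fin 2 → Plane → ℝ) (x : Plane) : rot W x = jac W x 1 0 - jac W x 0 1 := rfl

theorem memLp_jac (hc : Convex ℝ Ω) {V : Fin 2 → Plane → ℝ} (hV : ∀ i, V i ∈ 𝒯.feSpace)
    (i j : Fin 2) : MemLp (fun x => jac V x i j) ⊤ (volume.restrict Ω) :=
  Triangulation.memLp_partialDeriv hc i (hV j)

theorem memLp_rot (hc : Convex ℝ Ω) {V : Fin 2 → Plane → ℝ} (hV : ∀ i, V i ∈ 𝒯.feSpace) :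
    MemLp (rot V) ⊤ (volume.restrict Ω) := (memLp_jac hc hV 1 0).sub (memLp_jac hc hV 0 1)

theorem memLp_frob {μ : Measure Plane} {A B : Plane → Matrix (Fin 2) (Fin 2) ℝ}
    (hA : ∀ i j, MemLp (fun x => A x i j) ⊤ μ) (hB : ∀ i j, MemLp (fun x => B x i j) ⊤ μ) :
    MemLp (fun x => frob (A x) (B x)) ⊤ μ := by
  unfold frob
  refine memLp_finsetSum _ fun i _ => memLp_finsetSum _ fun j _ => ?_
  exact (hB i j).mul (hA i j)

theorem IsCordesCoefficient.memLp {α β ε : ℝ} (hα : 0 < α) (ho : IsOpen Ω)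
    {A : Plane → Matrix (Fin 2) (Fin 2) ℝ} (hA : IsCordesCoefficient Ω α β ε A) (i j : Fin 2) :
    MemLp (fun x => A x i j) ⊤ (volume.restrict Ω) := by
  refine memLp_top_of_bound (hA.aemeasurable i j).aestronglyMeasurable (Real.sqrt (2 * β ^ 2)) ?_
  filter_upwards [ae_restrict_mem ho.measurableSet] with x hx
  rw [Real.norm_eq_abs]
  refine Real.abs_le_sqrt (le_trans ?_ (frob_self_le hα (hA.elliptic x hx) (hA.symm x hx)))
  rw [frob_eq]
  fin_cases i <;> fin_cases j <;> simp <;>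
    nlinarith [sq_nonneg (A x 0 0), sq_nonneg (A x 0 1), sq_nonneg (A x 1 0), sq_nonneg (A x 1 1)]

namespace Sampling

variable (S : Sampling 𝒯) {α β ε : ℝ} {A : Plane → Matrix (Fin 2) (Fin 2) ℝ}

theorem memLp_frob_grad (hα : 0 < α) (ho : IsOpen Ω) (hc : Convex ℝ Ω)
    (hA : IsCordesCoefficient Ω α β ε A) (v : Plane → ℝ) :
    MemLp (fun x => frob (A x) (jac (S.grad v) x)) ⊤ (volume.restrict Ω) :=
  memLp_frob (hA.memLp hα ho) (memLp_jac hc (S.grad_mem_feSpace v))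

theorem isFiniteMeasure_restrict (hb : Bornology.IsBounded Ω) :
    IsFiniteMeasure (volume.restrict Ω) := ⟨by simpa using hb.measure_lt_top⟩

/-! ### The bilinear form and the load functional -/

theorem integrable_form (hα : 0 < α) (ho : IsOpen Ω) (hc : Convex ℝ Ω)
    (hb : Bornology.IsBounded Ω) (hA : IsCordesCoefficient Ω α β ε A) (v w : Plane → ℝ) :
    IntegrableOn (fun x => frob (A x) (jac (S.grad v) x) * frob (A x) (jac (S.grad w) x) +
      rot (S.grad v) x * rot (S.grad w) x) Ω := by
  have := isFiniteMeasure_restrict hb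
  refine Integrable.add ?_ ?_
  · exact ((S.memLp_frob_grad hα ho hc hA w).mul (S.memLp_frob_grad hα ho hc hA v)
      (r := ⊤)).integrable le_top
  · exact ((memLp_rot hc (S.grad_mem_feSpace w)).mul (memLp_rot hc (S.grad_mem_feSpace v))
      (r := ⊤)).integrable le_top

theorem form_eq (hα : 0 < α) (ho : IsOpen Ω) (hc : Convex ℝ Ω)
    (hb : Bornology.IsBounded Ω) (hA : IsCordesCoefficient Ω α β ε A) (v w : Plane → ℝ) :
    S.form A v w = ∫ x in Ω, (frob (A x) (jac (S.grad v) x) * frob (A x) (jac (S.grad w) x) +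
      rot (S.grad v) x * rot (S.grad w) x) :=
  𝒯.sum_integral hc (S.integrable_form hα ho hc hb hA v w)

theorem frob_add_right (A B C : Matrix (Fin 2) (Fin 2) ℝ) : frob A (B + C) = frob A B + frob A C := by
  simp only [frob_eq, Matrix.add_apply]; ring

theorem frob_smul_right (r : ℝ) (A B : Matrix (Fin 2) (Fin 2) ℝ) :
    frob A (r • B) = r * frob A B := by
  simp only [frob_eq, Matrix.smul_apply, smul_eq_mul]; ring

theorem form_comm (v w : Plane → ℝ) : S.form A v w = S.form A w v := by
  simp only [form, mul_comm]

theorem form_add_right (hα : 0 < α) (ho : IsOpen Ω) (hc : Convex ℝ Ω)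
    (hb : Bornology.IsBounded Ω) (hA : IsCordesCoefficient Ω α β ε A) (u v w : Plane → ℝ) :
    S.form A u (v + w) = S.form A u v + S.form A u w := by
  rw [S.form_eq hα ho hc hb hA, S.form_eq hα ho hc hb hA, S.form_eq hα ho hc hb hA,
    ← integral_add (S.integrable_form hα ho hc hb hA u v) (S.integrable_form hα ho hc hb hA u w)]
  refine integral_congr_ae ?_
  filter_upwards [jac_add_ae hc (S.grad_mem_feSpace v) (S.grad_mem_feSpace w)] with x hx
  simp only [grad_add, rot_eq, hx, frob_add_right, Matrix.add_apply]
  ring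

theorem form_smul_right (hα : 0 < α) (ho : IsOpen Ω) (hc : Convex ℝ Ω)
    (hb : Bornology.IsBounded Ω) (hA : IsCordesCoefficient Ω α β ε A) (r : ℝ) (u v : Plane → ℝ) :
    S.form A u (r • v) = r * S.form A u v := by
  rw [S.form_eq hα ho hc hb hA, S.form_eq hα ho hc hb hA, ← integral_const_mul]
  refine integral_congr_ae ?_
  filter_upwards [jac_smul_ae hc r (S.grad_mem_feSpace v)] with x hx
  simp only [grad_smul, rot_eq, hx, frob_smul_right, Matrix.smul_apply, smul_eq_mul]
  ring

/-- The bilinear form on `V_h^{0,0}` as a map into the dual space. -/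
def formMap (hα : 0 < α) (ho : IsOpen Ω) (hc : Convex ℝ Ω)
    (hb : Bornology.IsBounded Ω) (hA : IsCordesCoefficient Ω α β ε A) :
    S.zeroZero →ₗ[ℝ] Module.Dual ℝ S.zeroZero :=
  LinearMap.mk₂ ℝ (fun v w => S.form A v w)
    (fun u v w => by
      simp only [S.form_comm _ w.1]
      exact S.form_add_right hα ho hc hb hA _ _ _)
    (fun r u w => by
      simp only [S.form_comm _ w.1]
      exact S.form_smul_right hα ho hc hb hA _ _ _)
    (fun u v w => S.form_add_right hα ho hc hb hA _ _ _)
    (fun r u w => S.form_smul_right hα ho hc hb hA _ _ _)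

/-- The load functional `v ↦ (f, A : D G_h v)` on `V_h^{0,0}`. -/
def load (hα : 0 < α) (ho : IsOpen Ω) (hc : Convex ℝ Ω)
    (hb : Bornology.IsBounded Ω) (hA : IsCordesCoefficient Ω α β ε A) {f : Plane → ℝ}
    (hf : MemLp f 2 (volume.restrict Ω)) : Module.Dual ℝ S.zeroZero where
  toFun v := ∫ x in Ω, f x * frob (A x) (jac (S.grad v) x)
  map_add' v w := by
    have := isFiniteMeasure_restrict hb
    have hint : ∀ u : Plane → ℝ, Integrable (fun x => f x * frob (A x) (jac (S.grad u) x))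
        (volume.restrict Ω) := fun u =>
      hf.integrable_mul (q := 2) ((S.memLp_frob_grad hα ho hc hA u).mono_exponent le_top)
    rw [← integral_add (hint v) (hint w)]
    refine integral_congr_ae ?_
    filter_upwards [jac_add_ae hc (S.grad_mem_feSpace v) (S.grad_mem_feSpace w)] with x hx
    simp only [Submodule.coe_add, grad_add, hx, frob_add_right]
    ring
  map_smul' r v := by
    simp only [RingHom.id_apply, smul_eq_mul]
    rw [← integral_const_mul]
    refine integral_congr_ae ?_
    filter_upwards [jac_smul_ae hc r (S.grad_mem_feSpace v)] with x hx
    simp only [Submodule.coe_smul, grad_smul, hx, frob_smul_right]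
    ring

/-! ### Coercivity and boundedness -/

theorem integrable_frob_jac (hc : Convex ℝ Ω) (hb : Bornology.IsBounded Ω) (v : Plane → ℝ) :
    IntegrableOn (fun x => frob (jac (S.grad v) x) (jac (S.grad v) x)) Ω := by
  have := isFiniteMeasure_restrict hb
  have hj := memLp_jac hc (S.grad_mem_feSpace v)
  exact (memLp_frob hj hj).integrable le_top

theorem integral_frob_nonneg (v : Plane → ℝ) :
    0 ≤ ∫ x in Ω, frob (jac (S.grad v) x) (jac (S.grad v) x) :=
  integral_nonneg fun _ => frob_self_nonneg _

/-- `cordes_pointwise` integrated over Ω; the determinant term disappears by `integral_det_jac`,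
which uses the vanishing tangential trace. -/
theorem form_lower_bound (hα : 0 < α) (hβ : 0 < β) (ho : IsOpen Ω) (hc : Convex ℝ Ω)
    (hb : Bornology.IsBounded Ω) (hA : IsCordesCoefficient Ω α β ε A) {v : Plane → ℝ}
    (hv : v ∈ S.spaceZeroZero) :
    (α ^ 2 / β ^ 2) ^ 2 * ∫ x in Ω, frob (jac (S.grad v) x) (jac (S.grad v) x) ≤
      (1 + (1 + 1 / (α ^ 2 / β ^ 2)) * (β / α ^ 2) ^ 2) * S.form A v v := by
  have := isFiniteMeasure_restrict hb
  set K := (1 + 1 / (α ^ 2 / β ^ 2)) * (β / α ^ 2) ^ 2 with hK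
  have hK0 : 0 ≤ K := by positivity
  have hj := memLp_jac hc (S.grad_mem_feSpace v)
  have hdet := Triangulation.integral_det_jac ho hc hb (S.grad_mem_feSpace v) hv.2
  have hdi : Integrable (fun x => jac (S.grad v) x 0 0 * jac (S.grad v) x 1 1 -
      jac (S.grad v) x 1 0 * jac (S.grad v) x 0 1) (volume.restrict Ω) :=
    Integrable.sub (((hj 1 1).mul (hj 0 0) (r := ⊤)).integrable le_top)
      (((hj 0 1).mul (hj 1 0) (r := ⊤)).integrable le_top)
  have hF := S.integrable_frob_jac hc hb v
  have e : (α ^ 2 / β ^ 2) ^ 2 * ∫ x in Ω, frob (jac (S.grad v) x) (jac (S.grad v) x) =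
      ∫ x in Ω, ((α ^ 2 / β ^ 2) ^ 2 * frob (jac (S.grad v) x) (jac (S.grad v) x) +
        2 * (jac (S.grad v) x 0 0 * jac (S.grad v) x 1 1 -
          jac (S.grad v) x 1 0 * jac (S.grad v) x 0 1)) := by
    rw [integral_add (hF.const_mul _) (hdi.const_mul 2), integral_const_mul, integral_const_mul]
    simp only [jac, Matrix.of_apply]
    rw [hdet, mul_zero, add_zero]
  rw [e, S.form_eq hα ho hc hb hA, ← integral_const_mul]
  refine integral_mono_ae ((hF.const_mul _).add (hdi.const_mul 2))
    ((S.integrable_form hα ho hc hb hA v v).const_mul _) ?_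
  filter_upwards [ae_restrict_mem ho.measurableSet] with x hx
  have h := cordes_pointwise hα hβ (hA.elliptic x hx) (hA.symm x hx) (jac (S.grad v) x)
  rw [rot_eq]
  -- The factor 1 + K dominates both the coefficient K of (A : D)² and the coefficient 1 of the
  -- rotation term.
  nlinarith [sq_nonneg (frob (A x) (jac (S.grad v) x)),
    mul_nonneg hK0 (sq_nonneg (jac (S.grad v) x 1 0 - jac (S.grad v) x 0 1))]

/-- Pointwise, (A : D)² ≤ |A|²|D|² ≤ 2β²|D|² and (rot W)² ≤ 2|D|²; no boundary condition is needed.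
-/
theorem form_upper_bound (hα : 0 < α) (ho : IsOpen Ω) (hc : Convex ℝ Ω)
    (hb : Bornology.IsBounded Ω) (hA : IsCordesCoefficient Ω α β ε A) (v : Plane → ℝ) :
    S.form A v v ≤
      (2 * β ^ 2 + 2) * ∫ x in Ω, frob (jac (S.grad v) x) (jac (S.grad v) x) := by
  rw [S.form_eq hα ho hc hb hA, ← integral_const_mul]
  refine integral_mono_ae (S.integrable_form hα ho hc hb hA v v)
    ((S.integrable_frob_jac hc hb v).const_mul _) ?_
  filter_upwards [ae_restrict_mem ho.measurableSet] with x hx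
  have h1 := frob_sq_le (A x) (jac (S.grad v) x)
  have h2 := mul_le_mul_of_nonneg_right (frob_self_le hα (hA.elliptic x hx) (hA.symm x hx))
    (frob_self_nonneg (jac (S.grad v) x))
  have h3 : (jac (S.grad v) x 1 0 - jac (S.grad v) x 0 1) ^ 2 ≤
      2 * frob (jac (S.grad v) x) (jac (S.grad v) x) := by
    rw [frob_eq]
    nlinarith [sq_nonneg (jac (S.grad v) x 1 0 + jac (S.grad v) x 0 1),
      sq_nonneg (jac (S.grad v) x 0 0), sq_nonneg (jac (S.grad v) x 1 1)]
  rw [rot_eq]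
  nlinarith

/-! ### Definiteness and unique solvability -/

/-- Coercivity controls only DG_h v. Two further facts lead back to v: constant fields with zero
tangential trace vanish, and the Poincaré inequality bounds v by G_h v. -/
theorem eq_zero_of_form_eq_zero (hα : 0 < α) (hβ : 0 < β) (ho : IsOpen Ω) (hc : Convex ℝ Ω)
    (hb : Bornology.IsBounded Ω) (hA : IsCordesCoefficient Ω α β ε A) (hP : S.DiscretePoincare)
    {v : Plane → ℝ} (hv : v ∈ S.spaceZeroZero) (h0 : S.form A v v = 0) : v = 0 := by
  -- The empty domain is separate, since excluding nonzero constant fields needs a point of Ω.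
  rcases Ω.eq_empty_or_nonempty with hΩ | hne
  · ext x
    exact hv.1.1.2.2 x (by simp [hΩ])
  have hlow := S.form_lower_bound hα hβ ho hc hb hA hv
  rw [h0, mul_zero] at hlow
  have hpos : 0 < (α ^ 2 / β ^ 2) ^ 2 := by positivity
  have hint : ∫ x in Ω, frob (jac (S.grad v) x) (jac (S.grad v) x) = 0 := by
    nlinarith [S.integral_frob_nonneg v]
  rw [integral_eq_zero_iff_of_nonneg (fun _ => frob_self_nonneg _)
    (S.integrable_frob_jac hc hb v)] at hint
  have hder : ∀ j, ∀ᵐ x ∂(volume.restrict Ω), ∀ i, partialDeriv i (S.grad v j) x = 0 := by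
    intro j
    filter_upwards [hint] with x hx i
    change jac (S.grad v) x i j = 0
    simp only [frob_eq, Pi.zero_apply] at hx
    fin_cases i <;> fin_cases j <;> simp <;>
      nlinarith [sq_nonneg (jac (S.grad v) x 0 0), sq_nonneg (jac (S.grad v) x 0 1),
        sq_nonneg (jac (S.grad v) x 1 0), sq_nonneg (jac (S.grad v) x 1 1)]
  choose k hk using fun j =>
    Triangulation.exists_const_of_partialDeriv_eq_zero hc (S.grad_mem_feSpace v j) (hder j) ho
  have hk0 := Triangulation.const_eq_zero_of_tangentialTraceZero 𝒯 ho hc hb hne hv.2 hk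
  have hG : norm0 Ω (S.grad v) = 0 := by
    have : ∀ j, ∫ x in Ω, S.grad v j x ^ 2 = 0 := fun j =>
      setIntegral_eq_zero_of_forall_eq_zero fun x hx => by
        rw [hk j x (subset_closure hx), hk0]; simp
    simp [norm0, this]
  obtain ⟨C, hC⟩ := hP
  -- The case i = 0 suffices, as G_h v itself is zero on Ω.
  have hv0 := (hC v hv.1).1
  rw [hG, mul_zero, norm0, Real.sqrt_le_left le_rfl] at hv0
  have := isFiniteMeasure_restrict hb
  have hmem := Triangulation.memLp_of_mem_feSpace hb ho hv.1.1
  have hv2 : ∫ x in Ω, v x ^ 2 = 0 :=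
    le_antisymm (by simpa using hv0) (integral_nonneg fun _ => sq_nonneg _)
  rw [integral_eq_zero_iff_of_nonneg (fun _ => sq_nonneg _)
    ((hmem.mono_exponent le_top).integrable_sq)] at hv2
  -- Continuity turns vanishing almost everywhere into vanishing on Ω; the boundary condition and
  -- the extension by zero cover the rest of the plane.
  have hΩ0 : Set.EqOn v 0 Ω := by
    refine Measure.eqOn_open_of_ae_eq (μ := volume) ?_ ho (hv.1.1.1.mono subset_closure)
      continuousOn_const
    filter_upwards [hv2] with x hx
    simpa using hx
  ext x
  by_cases hx : x ∈ Ω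
  · exact hΩ0 hx
  by_cases hxc : x ∈ closure Ω
  · exact hv.1.2 x (by rw [ho.frontier_eq]; exact ⟨hxc, hx⟩)
  · exact hv.1.1.2.2 x hxc

/-- A definite form on a finite-dimensional space induces an injective map into the dual; equal
dimensions make it bijective, and the solution is the preimage of the load functional. -/
theorem existsUnique_isSolution (hα : 0 < α) (hβ : 0 < β) (ho : IsOpen Ω) (hc : Convex ℝ Ω)
    (hb : Bornology.IsBounded Ω) (hA : IsCordesCoefficient Ω α β ε A) (hP : S.DiscretePoincare)
    {f : Plane → ℝ} (hf : MemLp f 2 (volume.restrict Ω)) : ∃! u, S.IsSolution A f u := by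
  let B := S.formMap hα ho hc hb hA
  have hinj : Function.Injective B := by
    rw [injective_iff_map_eq_zero]
    intro v hv
    refine Subtype.ext (S.eq_zero_of_form_eq_zero hα hβ ho hc hb hA hP v.2 ?_)
    exact congrArg (fun φ => φ v) hv
  have hsurj : Function.Surjective B :=
    (LinearMap.injective_iff_surjective_of_finrank_eq_finrank
      (Subspace.dual_finrank_eq (K := ℝ) (V := S.zeroZero)).symm).1 hinj
  obtain ⟨u, hu⟩ := hsurj (S.load hα ho hc hb hA hf)
  refine ⟨u, ⟨u.2, fun v hv => congrArg (fun φ => φ ⟨v, hv⟩) hu⟩, fun w hw => ?_⟩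
  have : B ⟨w, hw.1⟩ = B u := by
    rw [hu]
    ext v
    exact hw.2 v v.2
  exact congrArg Subtype.val (hinj this)

theorem energy_lower_bound (hα : 0 < α) (hβ : 0 < β) (ho : IsOpen Ω) (hc : Convex ℝ Ω)
    (hb : Bornology.IsBounded Ω) (hA : IsCordesCoefficient Ω α β ε A) {v : Plane → ℝ}
    (hv : v ∈ S.spaceZeroZero) :
    Real.sqrt ((α ^ 2 / β ^ 2) ^ 2 / (1 + (1 + 1 / (α ^ 2 / β ^ 2)) * (β / α ^ 2) ^ 2)) *
      normJac Ω (S.grad v) ≤ S.energy A v := by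
  rw [normJac, energy, ← Real.sqrt_mul (by positivity), div_mul_eq_mul_div]
  exact Real.sqrt_le_sqrt ((div_le_iff₀' (by positivity)).2
    (S.form_lower_bound hα hβ ho hc hb hA hv))

theorem energy_upper_bound (hα : 0 < α) (ho : IsOpen Ω) (hc : Convex ℝ Ω)
    (hb : Bornology.IsBounded Ω) (hA : IsCordesCoefficient Ω α β ε A) (v : Plane → ℝ) :
    S.energy A v ≤ Real.sqrt (2 * β ^ 2 + 2) * normJac Ω (S.grad v) := by
  rw [normJac, energy, ← Real.sqrt_mul (by positivity)]
  exact Real.sqrt_le_sqrt (S.form_upper_bound hα ho hc hb hA v)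

end Sampling

end RecoveryFEM

end

open MeasureTheory RecoveryFEM in
theorem mainTheorem2 (α β ε : ℝ) (hα : 0 < α) (hβ : 0 < β) (hε : ε ∈ Set.Icc (0 : ℝ) 1) :
    ∃ c C : ℝ, 0 < c ∧ 0 < C ∧
      ∀ (Ω : Set Plane), IsOpen Ω → Convex ℝ Ω → Bornology.IsBounded Ω →
      ∀ (A : Plane → Matrix (Fin 2) (Fin 2) ℝ), IsCordesCoefficient Ω α β ε A →
      ∀ (𝒯 : Triangulation Ω) (S : Sampling 𝒯), S.DiscretePoincare →
        (∀ f : Plane → ℝ, MemLp f 2 (volume.restrict Ω) → ∃! u : Plane → ℝ, S.IsSolution A f u) ∧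
        ∀ v ∈ S.spaceZeroZero,
          c * normJac Ω (S.grad v) ≤ S.energy A v ∧ S.energy A v ≤ C * normJac Ω (S.grad v) := by
  refine ⟨Real.sqrt ((α ^ 2 / β ^ 2) ^ 2 / (1 + (1 + 1 / (α ^ 2 / β ^ 2)) * (β / α ^ 2) ^ 2)),
    Real.sqrt (2 * β ^ 2 + 2), Real.sqrt_pos.2 (by positivity), Real.sqrt_pos.2 (by positivity), ?_⟩
  intro Ω ho hc hb A hA 𝒯 S hP
  exact ⟨fun f hf => S.existsUnique_isSolution hα hβ ho hc hb hA hP hf, fun v hv =>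
    ⟨S.energy_lower_bound hα hβ ho hc hb hA hv, S.energy_upper_bound hα ho hc hb hA v⟩⟩
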